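/- Let $n\ge 0$, let $V$ be a vector space of dimension $n+1$ over the field $\mathbb{F}_2$, and let $\Delta=\mathsf{A}_n(2)$ be the associated building: its vertices are the nonzero proper subspaces of $V$, a vertex having type its dimension in $S=\{1,\dots,n\}$, and its simplices are the flags (sets of pairwise incident vertices, including the empty flag). Chambers are the maximal simplices; a panel of cotype $s\in S$ is a simplex $C\setminus\{v\}$ with $C$ a chamber and $v\in C$ of type $s$. Two distinct chambers are adjacent if they intersect in a panel, and two chambers are opposite if they are at maximal distance in the resulting chamber graph. Two simplices $\alpha,\beta$ are opposite if every chamber containing $\alpha$ is opposite some chamber containing $\beta$, and every chamber containing $\beta$ is opposite some chamber containing $\alpha$. The type of a simplex is the set of types of its vertices. An automorphism $\theta$ of the simplicial complex $\Delta$ is a duality if it induces a permutation $\pi_\theta$ of order $2$ on the type set $S$ (so dualities exist only for $n\ge 2$). Let $\mathrm{Opp}(\theta)$ be the set of simplices $\sigma$ that are opposite $\sigma^\theta$, and let $w_0$ denote the permutation $i\mapsto n+1-i$ of $S$. The automorphism $\theta$ is called domestic if $\mathrm{Opp}(\theta)$ contains no chamber; $J$-domestic, for $J\subseteq S$, if $\mathrm{Opp}(\theta)$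 contains no simplex of type $J$; exceptional domestic if it is domestic and the union of the types of the simplices in $\mathrm{Opp}(\theta)$ is all of $S$; and strongly exceptional domestic if it is domestic, but not $J$-domestic for any strict subset $J\subsetneq S$ invariant under $w_0\circ\pi_\theta$. Theorem. Every exceptional domestic duality $\theta$ of the building $\mathsf{A}_n(2)$ is strongly exceptional domestic. In particular, for every $s\in S$ there is a panel of cotype $s$ that $\theta$ maps to an opposite panel. -/

import Mathlib

/-!
The spherical building of type `A_n` attached to a vector space `V` of dimension `n + 1` over a
division ring `K`: the flag complex of the nonzero proper subspaces of `V`.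
For `K = ZMod 2` this is the building `A_n(2)`.
-/

namespace TypeABuilding

open Module

section Complex

variable (K V : Type*) [DivisionRing K] [AddCommGroup V] [Module K V]

/-- Vertices of the building: the nonzero proper subspaces of `V`, ordered by inclusion. -/
abbrev Vertex : Type _ := {U : Submodule K V // U ≠ ⊥ ∧ U ≠ ⊤}

/-- The type set `S = {1, ..., n}`, where `n + 1 = dim V`. -/
abbrev TypeSet : Type := {i : ℕ // 1 ≤ i ∧ i < finrank K V}

/-- The type of a vertex is its vector space dimension (so points of the projective space have
type `1`, lines have type `2`, and so on). -/
noncomputable def vertexType [FiniteDimensional K V] (U : Vertex K V) : TypeSet K V :=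
  ⟨finrank K U.1, Submodule.one_le_finrank_iff.mpr U.2.1, Submodule.finrank_lt U.2.2⟩

/-- The permutation `i ↦ n + 1 - i` of the type set induced by the longest element `w₀` of the
Coxeter group of type `A_n` (opposition of types). -/
noncomputable def oppType : Equiv.Perm (TypeSet K V) where
  toFun i := ⟨finrank K V - i.1, by have := i.2; omega⟩
  invFun i := ⟨finrank K V - i.1, by have := i.2; omega⟩
  left_inv i := by
    apply Subtype.ext
    have := i.2
    change finrank K V - (finrank K V - i.1) = i.1
    omega
  right_inv i := by
    apply Subtype.ext
    have := i.2
    change finrank K V - (finrank K V - i.1) = i.1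
    omega

variable {K V}

/-- Simplices are the flags: sets of pairwise incident vertices (the empty simplex included). -/
def IsSimplex (σ : Set (Vertex K V)) : Prop := IsChain (· ≤ ·) σ

/-- Chambers are the maximal simplices. -/
def IsChamber (C : Set (Vertex K V)) : Prop := Maximal IsSimplex C

/-- Panels are the simplices `C \ {v}`, with `C` a chamber and `v` a vertex of `C`. -/
def IsPanel (P : Set (Vertex K V)) : Prop :=
  ∃ C : Set (Vertex K V), IsChamber C ∧ ∃ v ∈ C, P = C \ {v}

/-- The type of a simplex: the set of types of its vertices. -/
def simplexType [FiniteDimensional K V] (σ : Set (Vertex K V)) : Set (TypeSet K V) :=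
  vertexType K V '' σ

variable (K V) in
/-- The chamber graph: distinct chambers are adjacent if they intersect in a panel. -/
def chamberGraph : SimpleGraph {C : Set (Vertex K V) // IsChamber C} where
  Adj C D := C ≠ D ∧ IsPanel (C.1 ∩ D.1)
  symm := ⟨fun C D h => ⟨h.1.symm, by rw [Set.inter_comm]; exact h.2⟩⟩
  loopless := ⟨fun _ h => h.1 rfl⟩

/-- Two chambers are opposite if they are at maximal distance in the chamber graph. -/
def OppositeChambers (C D : {C : Set (Vertex K V) // IsChamber C}) : Prop :=
  ∀ A B : {C : Set (Vertex K V) // IsChamber C},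
    (chamberGraph K V).dist A B ≤ (chamberGraph K V).dist C D

/-- Simplices `α`, `β` are opposite if each chamber containing `α` is opposite some chamber
containing `β`, and conversely. -/
def OppositeSimplices (α β : Set (Vertex K V)) : Prop :=
  (∀ A : {C : Set (Vertex K V) // IsChamber C}, α ⊆ A.1 →
      ∃ B : {C : Set (Vertex K V) // IsChamber C}, β ⊆ B.1 ∧ OppositeChambers A B) ∧
  (∀ B : {C : Set (Vertex K V) // IsChamber C}, β ⊆ B.1 →
      ∃ A : {C : Set (Vertex K V) // IsChamber C}, α ⊆ A.1 ∧ OppositeChambers A B)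

variable (K V) in
/-- Automorphisms of the building: simplicial complex automorphisms, given by their action on
the vertices. They need not preserve types. -/
structure Automorphism where
  toPerm : Equiv.Perm (Vertex K V)
  isSimplex_image_iff : ∀ σ : Set (Vertex K V), IsSimplex (toPerm '' σ) ↔ IsSimplex σ

namespace Automorphism

variable (θ : Automorphism K V)

/-- The image `σ^θ` of a simplex. -/
def image (σ : Set (Vertex K V)) : Set (Vertex K V) := θ.toPerm '' σ

/-- The opposite geometry `Opp(θ)`: the simplices mapped to an opposite simplex. -/
def Opp : Set (Set (Vertex K V)) := {σ | IsSimplex σ ∧ OppositeSimplices σ (θ.image σ)}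

/-- `θ` is domestic if it maps no chamber to an opposite chamber. -/
def Domestic : Prop := ¬ ∃ C ∈ θ.Opp, IsChamber C

variable [FiniteDimensional K V]

/-- `π` is the permutation `π_θ` of the type set induced by `θ`. It is unique, because every
type is the type of some vertex. -/
def InducesOnTypes (π : Equiv.Perm (TypeSet K V)) : Prop :=
  ∀ v : Vertex K V, vertexType K V (θ.toPerm v) = π (vertexType K V v)

/-- `θ` is a duality if it induces a permutation of order `2` on the type set. -/
def IsDuality : Prop := ∃ π : Equiv.Perm (TypeSet K V), θ.InducesOnTypes π ∧ orderOf π = 2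

/-- `Type(θ)`: the union of all `J` for which some type `J` simplex is in `Opp(θ)`. -/
def typ : Set (TypeSet K V) := ⋃₀ {J | ∃ σ ∈ θ.Opp, simplexType σ = J}

/-- `θ` is `J`-domestic if it maps no type `J` simplex to an opposite simplex. -/
def JDomestic (J : Set (TypeSet K V)) : Prop := ¬ ∃ σ ∈ θ.Opp, simplexType σ = J

/-- `θ` is exceptional domestic if it is domestic with full opposition diagram. -/
def ExceptionalDomestic : Prop := θ.Domestic ∧ θ.typ = Set.univ

/-- `θ` is strongly exceptional domestic if it is domestic, but not `J`-domestic for any strict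
subset `J` of the type set invariant under `w₀ ∘ π_θ`. -/
def StronglyExceptionalDomestic : Prop :=
  θ.Domestic ∧ ∃ π : Equiv.Perm (TypeSet K V), θ.InducesOnTypes π ∧
    ∀ J : Set (TypeSet K V), J ≠ Set.univ → (fun i => oppType K V (π i)) '' J = J →
      ¬ θ.JDomestic J

end Automorphism

end Complex

end TypeABuilding

/-!
Exceptional domestic dualities of the building `A_n(2)` are strongly exceptional domestic.
-/

/-! A type permutation of order two induced by an automorphism is `oppType`, so θ reverses
inclusion. Over 𝔽₂ a hyperplane is the kernel of exactly one nonzero functional, so θ is given by a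
nondegenerate, not necessarily symmetric, bilinear form B: θ sends U to its right perp
(`InducesOnTypes.exists_form`).

The chamber graph distance of two complete flags is the number of inversions of their relative
position, and it is maximal exactly when members of complementary dimension are complements
(`IsFullFlag.oppositeChambers_iff`). With `IsFullFlag.exists_opposite` this puts every flag on whose
members B is nondegenerate into Opp(θ) (`IsFullFlag.mem_Opp`). Hence domesticity excludes complete
flags of nondegenerate subspaces. Conversely, vertices of simplices in Opp(θ) are complementary to
their images; for a point this means B x x = 1, so fullness of the opposition diagram makes B
non-alternating.

The heart is `exists_flag_nondegenerateOn_of_ne`: these two properties yield, for each s, a complete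
flag that is nondegenerate in every dimension but s. One splits off a vector y with B y y = 1 and
passes to its perp by induction; a perp of dimension at least three must again be non-alternating,
which `exists_inf_ker_not_alternating` achieves by a good choice of y. Removing the vertex of type s
leaves a panel mapped to an opposite panel, and the faces of such panels give all types J ≠ S. -/

namespace TypeABuilding
open Module

/-! ### Chambers as complete flags indexed by dimension. -/

section FullFlags

variable {K V : Type*} [DivisionRing K] [AddCommGroup V] [Module K V]

theorem mem_of_covBy {A X : Submodule K V} (h : A ⋖ X) {x z : V} (hx : x ∈ X) (hxA : x ∉ A)
    (hz : z ∈ X) : ∃ a : K, z - a • x ∈ A := by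
  have h1 : A ⊔ K ∙ x = X := by
    refine h.eq_or_eq le_sup_left (sup_le h.le ?_) |>.resolve_left ?_
    · simpa using hx
    · intro h2
      exact hxA (by rw [← h2]; exact Submodule.mem_sup_right (Submodule.mem_span_singleton_self x))
  rw [← h1] at hz
  obtain ⟨y, hy, w, hw, rfl⟩ := Submodule.mem_sup.1 hz
  obtain ⟨a, rfl⟩ := Submodule.mem_span_singleton.1 hw
  exact ⟨a, by simpa using hy⟩

variable [FiniteDimensional K V]

theorem finrank_sup_span_singleton {A : Submodule K V} {x : V} (hx : x ∉ A) :
    finrank K (A ⊔ K ∙ x : Submodule K V) = finrank K A + 1 := by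
  have hx0 : x ≠ 0 := fun h => hx (h ▸ A.zero_mem)
  have h := Submodule.finrank_sup_add_finrank_inf_eq A (K ∙ x)
  have h2 : A ⊓ K ∙ x = ⊥ := ((Submodule.disjoint_span_singleton' hx0).2 hx).eq_bot
  rw [h2, finrank_bot, finrank_span_singleton hx0] at h
  simpa using h

theorem covBy_of_finrank {A B : Submodule K V} (h : A ≤ B)
    (hf : finrank K B = finrank K A + 1) : A ⋖ B := by
  refine ⟨lt_of_le_of_ne h (by rintro rfl; omega), fun X h1 h2 => ?_⟩
  have := Submodule.finrank_lt_finrank_of_lt h1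
  have := Submodule.finrank_lt_finrank_of_lt h2
  omega

theorem finrank_of_covBy {A B : Submodule K V} (h : A ⋖ B) :
    finrank K B = finrank K A + 1 := by
  obtain ⟨x, hx, hxA⟩ := Set.exists_of_ssubset h.lt
  rw [← finrank_sup_span_singleton hxA]
  refine congrArg (fun X : Submodule K V => finrank K X) ?_
  refine ((h.eq_or_eq le_sup_left (sup_le h.le ?_)).resolve_left ?_).symm
  · simpa using hx
  · intro h2
    exact hxA (h2 ▸ Submodule.mem_sup_right (Submodule.mem_span_singleton_self x))

theorem exists_finrank_between {A B : Submodule K V} (h : A ≤ B) {d : ℕ}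
    (h1 : finrank K A ≤ d) (h2 : d ≤ finrank K B) :
    ∃ X : Submodule K V, A ≤ X ∧ X ≤ B ∧ finrank K X = d := by
  induction d, h1 using Nat.le_induction with
  | base => exact ⟨A, le_rfl, h, rfl⟩
  | succ d hd ih =>
    obtain ⟨X, hAX, hXB, hX⟩ := ih (by omega)
    obtain ⟨x, hxB, hx⟩ := Set.exists_of_ssubset
      (lt_of_le_of_ne hXB (by rintro rfl; omega) : X < B)
    refine ⟨X ⊔ K ∙ x, hAX.trans le_sup_left, sup_le hXB (by simpa using hxB), ?_⟩
    rw [finrank_sup_span_singleton hx, hX]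

/-- A complete flag of subspaces, indexed by dimension and constantly `⊤` from `dim V` on. -/
structure IsFullFlag (c : ℕ → Submodule K V) : Prop where
  mono : Monotone c
  finrank_eq : ∀ i, finrank K (c i) = min i (finrank K V)

namespace IsFullFlag

variable {c d : ℕ → Submodule K V}

theorem of_step (h1 : ∀ i, i < finrank K V → c i ≤ c (i + 1))
    (h2 : ∀ i, finrank K (c i) = min i (finrank K V)) : IsFullFlag c := by
  refine ⟨monotone_nat_of_le_succ fun i => ?_, h2⟩
  by_cases h : i < finrank K V
  · exact h1 i h
  · have : c (i + 1) = ⊤ := Submodule.eq_top_of_finrank_eq (by rw [h2]; omega)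
    rw [this]; exact le_top

theorem bot (hc : IsFullFlag c) : c 0 = ⊥ := by
  have := hc.finrank_eq 0
  simpa using this

theorem top (hc : IsFullFlag c) {i : ℕ} (hi : finrank K V ≤ i) : c i = ⊤ :=
  Submodule.eq_top_of_finrank_eq (by rw [hc.finrank_eq]; omega)

theorem covBy (hc : IsFullFlag c) {i : ℕ} (hi : i < finrank K V) : c i ⋖ c (i + 1) :=
  covBy_of_finrank (hc.mono i.le_succ) (by rw [hc.finrank_eq, hc.finrank_eq]; omega)

omit [FiniteDimensional K V] in
theorem ne_bot (hc : IsFullFlag c) {i : ℕ} (h : 1 ≤ i) (h' : i < finrank K V) : c i ≠ ⊥ := by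
  intro h0
  have := hc.finrank_eq i
  rw [h0, finrank_bot] at this
  omega

omit [FiniteDimensional K V] in
theorem ne_top (hc : IsFullFlag c) {i : ℕ} (h' : i < finrank K V) : c i ≠ ⊤ := by
  intro h0
  have := hc.finrank_eq i
  rw [h0, finrank_top] at this
  omega

/-- The vertex of dimension `i` of a complete flag. -/
def vertex (hc : IsFullFlag c) (i : TypeSet K V) : Vertex K V :=
  ⟨c i, hc.ne_bot i.2.1 i.2.2, hc.ne_top i.2.2⟩

theorem vertexType_vertex (hc : IsFullFlag c) (i : TypeSet K V) :
    vertexType K V (hc.vertex i) = i := by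
  apply Subtype.ext
  change finrank K (c i) = i
  rw [hc.finrank_eq]
  have := i.2
  omega

end IsFullFlag

/-- The set of vertices occurring in a family of subspaces. -/
def flagSet (c : ℕ → Submodule K V) : Set (Vertex K V) := {v | ∃ i, v.1 = c i}

namespace IsFullFlag

variable {c d : ℕ → Submodule K V}

theorem val_eq (hc : IsFullFlag c) {v : Vertex K V} (hv : v ∈ flagSet c) :
    v.1 = c (vertexType K V v).1 := by
  obtain ⟨i, hi⟩ := hv
  change v.1 = c (finrank K v.1)
  rw [hi, hc.finrank_eq]
  rcases le_total i (finrank K V) with h | h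
  · rw [min_eq_left h]
  · rw [min_eq_right h, hc.top h, hc.top le_rfl]

theorem eq_vertex (hc : IsFullFlag c) {v : Vertex K V} (hv : v ∈ flagSet c) :
    v = hc.vertex (vertexType K V v) := Subtype.ext (hc.val_eq hv)

omit [FiniteDimensional K V] in
theorem vertex_mem (hc : IsFullFlag c) (i : TypeSet K V) : hc.vertex i ∈ flagSet c := ⟨i, rfl⟩

omit [FiniteDimensional K V] in
theorem isSimplex (hc : IsFullFlag c) : IsSimplex (flagSet c) := by
  rintro u ⟨i, hi⟩ v ⟨j, hj⟩ -
  rcases le_total i j with h | h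
  · left; change u.1 ≤ v.1; rw [hi, hj]; exact hc.mono h
  · right; change v.1 ≤ u.1; rw [hi, hj]; exact hc.mono h

theorem isChamber (hc : IsFullFlag c) : IsChamber (flagSet c) := by
  refine ⟨hc.isSimplex, fun τ hτ hcτ v hv => ?_⟩
  have hw := hcτ (hc.vertex_mem (vertexType K V v))
  have hf : finrank K (hc.vertex (vertexType K V v)).1 = finrank K v.1 :=
    congrArg Subtype.val (hc.vertexType_vertex (vertexType K V v))
  have hvw : v = hc.vertex (vertexType K V v) := by
    apply Subtype.ext
    rcases hτ.total hv hw with h | h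
    · exact Submodule.eq_of_le_of_finrank_le h hf.le
    · exact (Submodule.eq_of_le_of_finrank_le h hf.ge).symm
  rw [hvw]
  exact hc.vertex_mem _

theorem ext_of_lt (hc : IsFullFlag c) (hd : IsFullFlag d)
    (h : ∀ i, 1 ≤ i → i < finrank K V → c i = d i) : c = d := by
  funext i
  rcases Nat.eq_zero_or_pos i with rfl | h1
  · rw [hc.bot, hd.bot]
  rcases lt_or_ge i (finrank K V) with h2 | h2
  · exact h i h1 h2
  · rw [hc.top h2, hd.top h2]

theorem eq_of_vertex_mem (hc : IsFullFlag c) (hd : IsFullFlag d) (i : TypeSet K V)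
    (h : hc.vertex i ∈ flagSet d) : c i = d i := by
  have := hd.val_eq h
  rwa [hc.vertexType_vertex] at this

theorem flagSet_injective (hc : IsFullFlag c) (hd : IsFullFlag d) (h : flagSet c = flagSet d) :
    c = d :=
  hc.ext_of_lt hd fun i h1 h2 =>
    hc.eq_of_vertex_mem hd ⟨i, h1, h2⟩ (h ▸ hc.vertex_mem ⟨i, h1, h2⟩)

end IsFullFlag

/-- No dimension can be skipped: if U in M has dimension i and W is a smallest larger member, a
subspace of dimension i + 1 between them is comparable with all of M, so maximality puts it into M.
-/
theorem exists_mem_of_isMaxChain {M : Set (Submodule K V)}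
    (hM : IsMaxChain (· ≤ ·) M) {i : ℕ} (hi : i ≤ finrank K V) :
    ∃ U ∈ M, finrank K U = i := by
  induction i with
  | zero => exact ⟨⊥, hM.bot_mem, finrank_bot K V⟩
  | succ i ih =>
    obtain ⟨U, hUM, hU⟩ := ih (by omega)
    obtain ⟨W, ⟨hWM, hW⟩, hmin⟩ := exists_minimalFor_of_wellFoundedLT
      (fun W => W ∈ M ∧ i < finrank K W) (fun W : Submodule K V => finrank K W)
      ⟨⊤, hM.top_mem, by rw [finrank_top]; omega⟩
    have key : ∀ Y ∈ M, ∀ Z ∈ M, finrank K Y ≤ finrank K Z → Y ≤ Z := by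
      intro Y hY Z hZ h
      rcases hM.isChain.total hY hZ with h1 | h1
      · exact h1
      · exact (Submodule.eq_of_le_of_finrank_le h1 h).ge
    obtain ⟨X, hUX, hXW, hX⟩ := exists_finrank_between (key U hUM W hWM (by omega))
      (d := i + 1) (by omega) hW
    refine ⟨X, ?_, hX⟩
    have hins : IsChain (· ≤ ·) (insert X M) := by
      refine hM.isChain.insert fun Y hY _ => ?_
      rcases le_or_gt (finrank K Y) i with h | h
      · exact Or.inr ((key Y hY U hUM (by omega)).trans hUX)
      · refine Or.inl (hXW.trans (key W hWM Y hY ?_))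
        rcases le_total (finrank K W) (finrank K Y) with h1 | h1
        · exact h1
        · exact hmin ⟨hY, h⟩ h1
    rw [hM.2 hins (Set.subset_insert X M)]
    exact Set.mem_insert X M

theorem exists_isFullFlag {σ : Set (Vertex K V)} (hσ : IsSimplex σ) :
    ∃ c : ℕ → Submodule K V, IsFullFlag c ∧ σ ⊆ flagSet c := by
  have h1 : IsChain (· ≤ ·) (Subtype.val '' σ : Set (Submodule K V)) := by
    rintro _ ⟨u, hu, rfl⟩ _ ⟨v, hv, rfl⟩ -
    exact hσ.total hu hv
  obtain ⟨M, hM, hσM⟩ := h1.exists_maxChain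
  choose c hcM hc using fun i : ℕ =>
    exists_mem_of_isMaxChain hM (i := min i (finrank K V)) (min_le_right _ _)
  have key : ∀ Y ∈ M, ∀ Z ∈ M, finrank K Y ≤ finrank K Z → Y ≤ Z := by
    intro Y hY Z hZ h
    rcases hM.isChain.total hY hZ with h1 | h1
    · exact h1
    · exact (Submodule.eq_of_le_of_finrank_le h1 h).ge
  refine ⟨c, ⟨fun i j hij => key _ (hcM i) _ (hcM j) ?_, hc⟩, fun v hv => ⟨finrank K v.1, ?_⟩⟩
  · rw [hc, hc]; omega
  · have hf : finrank K (c (finrank K v.1)) = finrank K v.1 := by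
      rw [hc]; exact min_eq_left (Submodule.finrank_le _)
    exact le_antisymm (key _ (hσM ⟨v, hv, rfl⟩) _ (hcM _) hf.ge)
      (key _ (hcM _) _ (hσM ⟨v, hv, rfl⟩) hf.le)

theorem IsChamber.exists_isFullFlag {C : Set (Vertex K V)} (hC : IsChamber C) :
    ∃ c : ℕ → Submodule K V, IsFullFlag c ∧ C = flagSet c := by
  obtain ⟨c, hc, h⟩ := TypeABuilding.exists_isFullFlag hC.1
  exact ⟨c, hc, h.antisymm (hC.2 hc.isSimplex h)⟩

namespace IsFullFlag

variable {c d : ℕ → Submodule K V}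

/-- The chamber of a complete flag. -/
def chamber (hc : IsFullFlag c) : {C : Set (Vertex K V) // IsChamber C} :=
  ⟨flagSet c, hc.isChamber⟩

theorem adj_of_eq (hc : IsFullFlag c) (hd : IsFullFlag d) {i : ℕ}
    (hne : c i ≠ d i) (h : ∀ k, k ≠ i → c k = d k) :
    (chamberGraph K V).Adj hc.chamber hd.chamber := by
  have h1 : 1 ≤ i := by
    rcases Nat.eq_zero_or_pos i with rfl | h1
    · exact absurd (by rw [hc.bot, hd.bot]) hne
    · exact h1
  have h2 : i < finrank K V := by
    by_contra h2
    exact hne (by rw [hc.top (not_lt.1 h2), hd.top (not_lt.1 h2)])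
  refine ⟨fun he => hne (congrFun (hc.flagSet_injective hd (congrArg Subtype.val he)) i), ?_⟩
  refine ⟨flagSet c, hc.isChamber, hc.vertex ⟨i, h1, h2⟩, hc.vertex_mem _, ?_⟩
  change flagSet c ∩ flagSet d = _
  ext v
  constructor
  · rintro ⟨hvc, hvd⟩
    refine ⟨hvc, ?_⟩
    rintro rfl
    exact hne (hc.eq_of_vertex_mem hd _ hvd)
  · rintro ⟨hvc, hv⟩
    refine ⟨hvc, _, (hc.val_eq hvc).trans (h _ ?_)⟩
    rintro hi
    apply hv
    rw [Set.mem_singleton_iff, hc.eq_vertex hvc]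
    congr 1
    exact Subtype.ext hi

/-- The common panel is a chamber `e` without a vertex v, so both flags agree with `e` away from the
type of v. -/
theorem eq_of_adj (hc : IsFullFlag c) (hd : IsFullFlag d)
    (h : (chamberGraph K V).Adj hc.chamber hd.chamber) :
    ∃ i, c i ≠ d i ∧ 1 ≤ i ∧ i < finrank K V ∧ ∀ k, k ≠ i → c k = d k := by
  obtain ⟨hne, E, hE, v, hv, hEv⟩ := h
  obtain ⟨e, he, rfl⟩ := hE.exists_isFullFlag
  change flagSet c ∩ flagSet d = _ at hEv
  have key : ∀ k, k ≠ (vertexType K V v).1 → c k = d k := by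
    intro k hk
    rcases Nat.eq_zero_or_pos k with rfl | h1
    · rw [hc.bot, hd.bot]
    rcases lt_or_ge k (finrank K V) with h2 | h2
    · have hm : he.vertex ⟨k, h1, h2⟩ ∈ flagSet e \ {v} := by
        refine ⟨he.vertex_mem _, ?_⟩
        rintro rfl
        exact hk (by rw [he.vertexType_vertex])
      rw [← hEv] at hm
      exact (he.eq_of_vertex_mem hc _ hm.1).symm.trans (he.eq_of_vertex_mem hd _ hm.2)
    · rw [hc.top h2, hd.top h2]
  refine ⟨(vertexType K V v).1, fun h => hne ?_, (vertexType K V v).2.1,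
    (vertexType K V v).2.2, key⟩
  have hcd : c = d := by
    funext k
    by_cases hk : k = (vertexType K V v).1
    · rw [hk, h]
    · exact key k hk
  subst hcd
  rfl

end IsFullFlag

end FullFlags

/-! ### Inversions of the relative position of two flags. -/

section RelativePosition

variable {K V : Type*} [DivisionRing K] [AddCommGroup V] [Module K V]

/-- The first index at which the flag `d` meets `B` outside `A`. -/
noncomputable def jump (d : ℕ → Submodule K V) (A B : Submodule K V) : ℕ :=
  sInf {j | ¬ B ⊓ d j ≤ A}

open Classical in
/-- The number of boxes of the Rothe diagram of the relative position with respect to `d` that lie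
in the row of the step from `A` to `B`. -/
noncomputable def rotheRow (d : ℕ → Submodule K V) (A B : Submodule K V) : ℕ :=
  ((Finset.range (finrank K V)).filter fun j => B ⊓ d (j + 1) ≤ A ⊓ d j).card

/-- The size of the Rothe diagram of the relative position of two complete flags. -/
noncomputable def flagLength (c d : ℕ → Submodule K V) : ℕ :=
  ∑ i ∈ Finset.range (finrank K V), rotheRow d (c i) (c (i + 1))

variable {d : ℕ → Submodule K V} {A B X X' : Submodule K V}

theorem le_of_lt_jump {j : ℕ} (hj : j < jump d A B) : B ⊓ d j ≤ A := by
  by_contra h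
  exact Nat.notMem_of_lt_sInf hj h

theorem jump_le {j : ℕ} (h : ¬ B ⊓ d j ≤ A) : jump d A B ≤ j := Nat.sInf_le h

variable [FiniteDimensional K V]

namespace IsFullFlag

variable {c : ℕ → Submodule K V}

theorem jump_spec (hd : IsFullFlag d) (h : A < B) : ¬ B ⊓ d (jump d A B) ≤ A := by
  have : (finrank K V) ∈ {j | ¬ B ⊓ d j ≤ A} := by
    simp only [Set.mem_ofPred_eq, hd.top le_rfl, inf_top_eq]
    exact h.not_ge
  exact Nat.sInf_mem ⟨_, this⟩

theorem jump_le_finrank (hd : IsFullFlag d) (h : A < B) : jump d A B ≤ finrank K V := by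
  apply jump_le
  rw [hd.top le_rfl, inf_top_eq]
  exact h.not_ge

theorem jump_pos (hd : IsFullFlag d) (h : A < B) : 1 ≤ jump d A B := by
  by_contra h0
  have h1 := hd.jump_spec h
  rw [show jump d A B = 0 by omega, hd.bot, inf_bot_eq] at h1
  exact h1 bot_le

theorem not_le_of_jump_le (hd : IsFullFlag d) (h : A < B) {j : ℕ} (hj : jump d A B ≤ j) :
    ¬ B ⊓ d j ≤ A :=
  fun h1 => hd.jump_spec h ((inf_le_inf_left B (hd.mono hj)).trans h1)

/-- A vector realising the jump; the last piece of `d` before the jump does not contain it. -/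
theorem exists_mem_jump (hd : IsFullFlag d) (h : A < B) :
    ∃ x ∈ B, x ∈ d (jump d A B) ∧ x ∉ A ∧
      ∀ z ∈ d (jump d A B), ∃ a : K, z - a • x ∈ d (jump d A B - 1) := by
  obtain ⟨x, ⟨hxB, hxd⟩, hxA⟩ := SetLike.not_le_iff_exists.1 (hd.jump_spec h)
  have hp := hd.jump_pos h
  have hN := hd.jump_le_finrank h
  refine ⟨x, hxB, hxd, hxA, fun z hz => ?_⟩
  have hcov := hd.covBy (i := jump d A B - 1) (by omega)
  rw [Nat.sub_add_cancel hp] at hcov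
  refine mem_of_covBy hcov hxd (fun hx => hxA ?_) hz
  exact le_of_lt_jump (j := jump d A B - 1) (by omega) ⟨hxB, hx⟩

/-- If the jumps agreed, a vector realising the second could be corrected by a multiple of one
realising the first so as to lie one step earlier in `d`, hence in X. -/
theorem jump_ne (hd : IsFullFlag d) (hAX : A < X) (hXB : X < B) :
    jump d A X ≠ jump d X B := by
  intro h
  obtain ⟨x, hxX, hxd, hxA, hx⟩ := hd.exists_mem_jump hAX
  obtain ⟨y, hyB, hyd, hyX, -⟩ := hd.exists_mem_jump hXB
  obtain ⟨a, ha⟩ := hx y (h ▸ hyd)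
  have hp := hd.jump_pos hXB
  have := le_of_lt_jump (d := d) (A := X) (B := B) (j := jump d A X - 1) (by omega)
    ⟨B.sub_mem hyB (B.smul_mem a (hXB.le hxX)), ha⟩
  exact hyX (by simpa using X.add_mem this (X.smul_mem a hxX))

/-- The subspace L is A extended by a vector of B that leaves A as early as possible along `d`. -/
theorem exists_ascending (hd : IsFullFlag d) (hAX : A ⋖ X) (hXB : X ⋖ B) :
    ∃ L, A ⋖ L ∧ L ⋖ B ∧ jump d A L < jump d L B := by
  have hAB := hAX.lt.trans hXB.lt
  obtain ⟨x, hxB, hxd, hxA, hx⟩ := hd.exists_mem_jump hAB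
  have hp := hd.jump_pos hAB
  have hLB : A ⊔ K ∙ x ≤ B := sup_le hAB.le (by simpa using hxB)
  have hxL : x ∈ A ⊔ K ∙ x := Submodule.mem_sup_right (Submodule.mem_span_singleton_self x)
  have h1 : A ⋖ A ⊔ K ∙ x :=
    covBy_of_finrank le_sup_left (finrank_sup_span_singleton hxA)
  have h2 : A ⊔ K ∙ x ⋖ B := by
    refine covBy_of_finrank hLB ?_
    rw [finrank_sup_span_singleton hxA, finrank_of_covBy hXB, finrank_of_covBy hAX]
  refine ⟨A ⊔ K ∙ x, h1, h2, ?_⟩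
  have h3 : jump d A (A ⊔ K ∙ x) ≤ jump d A B := jump_le fun h => hxA (h ⟨hxL, hxd⟩)
  refine h3.trans_lt (lt_of_not_ge fun h => hd.not_le_of_jump_le h2.lt h ?_)
  rintro z ⟨hzB, hzd⟩
  obtain ⟨a, ha⟩ := hx z hzd
  have := le_of_lt_jump (d := d) (A := A) (B := B) (j := jump d A B - 1) (by omega)
    ⟨B.sub_mem hzB (B.smul_mem a hxB), ha⟩
  have h4 := Submodule.add_mem _ ((le_sup_left : A ≤ A ⊔ K ∙ x) this)
    (Submodule.smul_mem _ a hxL)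
  simpa using h4

theorem exists_ne_covBy (hAX : A ⋖ X) (hXB : X ⋖ B) : ∃ X', X' ≠ X ∧ A ⋖ X' ∧ X' ⋖ B := by
  obtain ⟨y, hyB, hyX⟩ := Set.exists_of_ssubset hXB.lt
  have hyA : y ∉ A := fun h => hyX (hAX.le h)
  refine ⟨A ⊔ K ∙ y, ?_, covBy_of_finrank le_sup_left (finrank_sup_span_singleton hyA), ?_⟩
  · rintro h
    exact hyX (h ▸ Submodule.mem_sup_right (Submodule.mem_span_singleton_self y))
  · refine covBy_of_finrank (sup_le (hAX.le.trans hXB.le) (by simpa using hyB)) ?_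
    rw [finrank_sup_span_singleton hyA, finrank_of_covBy hXB, finrank_of_covBy hAX]

/-- Replacing X by any other intermediate subspace interchanges the two jumps a < b, which creates
exactly one inversion. -/
theorem rotheRow_swap (hd : IsFullFlag d) (hAX : A ⋖ X) (hXB : X ⋖ B) (hAX' : A ⋖ X')
    (hX'B : X' ⋖ B) (hne : X' ≠ X) (hlt : jump d A X < jump d X B) :
    rotheRow d A X' + rotheRow d X' B = rotheRow d A X + rotheRow d X B + 1 := by
  classical
  have hXX' : X ⊓ X' ≤ A := by
    rcases hAX.eq_or_eq (le_inf hAX.le hAX'.le) inf_le_left with h | h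
    · exact h.le
    · have h1 : X ≤ X' := h ▸ inf_le_right
      rcases hAX'.eq_or_eq hAX.le h1 with h2 | h2
      · exact absurd h2 hAX.lt.ne'
      · exact absurd h2.symm hne
  have hA : A ≤ X := hAX.le
  have hX : X ≤ B := hXB.le
  have hA' : A ≤ X' := hAX'.le
  have hX' : X' ≤ B := hX'B.le
  obtain ⟨x, hxX, hxd, hxA, hx⟩ := hd.exists_mem_jump hAX.lt
  obtain ⟨y, hyB, hyd, hyX, -⟩ := hd.exists_mem_jump hXB.lt
  have hp := hd.jump_pos hAX.lt
  have hbN := hd.jump_le_finrank hXB.lt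
  have hAlow : ∀ j, j < jump d A X → X ⊓ d j ≤ A := fun j => le_of_lt_jump
  have hXlow : ∀ j, j < jump d X B → B ⊓ d j ≤ X := fun j => le_of_lt_jump
  have hAup : ∀ j, jump d A X ≤ j → ¬ X ⊓ d j ≤ A := fun j => hd.not_le_of_jump_le hAX.lt
  have hXup : ∀ j, jump d X B ≤ j → ¬ B ⊓ d j ≤ X := fun j => hd.not_le_of_jump_le hXB.lt
  generalize jump d A X = a at *
  generalize jump d X B = b at *
  have hxX' : x ∉ X' := fun h => hxA (hXX' ⟨hxX, h⟩)
  have hX'A : ∀ j, b ≤ j → ¬ X' ⊓ d j ≤ A := by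
    intro j hj h
    obtain ⟨z, hzX', hzA⟩ := Set.exists_of_ssubset hAX'.lt
    have hzX : z ∉ X := fun h => hzA (hXX' ⟨h, hzX'⟩)
    obtain ⟨s, hs⟩ := mem_of_covBy hXB (hX' hzX') hzX hyB
    obtain ⟨t, ht⟩ := mem_of_covBy hAX hxX hxA hs
    -- Modulo A, y is a combination of z in X' and of x. Removing the multiple of x, which already
    -- lies in `d j`, moves y into X'.
    have hr : y - t • x ∈ X' := by
      have := X'.add_mem (X'.smul_mem s hzX') (hA' ht)
      convert this using 1; abel
    have hrd : y - t • x ∈ d j :=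
      Submodule.sub_mem _ (hd.mono hj hyd) (Submodule.smul_mem _ t (hd.mono (hlt.le.trans hj) hxd))
    have := hA (h ⟨hr, hrd⟩)
    exact hyX (by simpa using X.add_mem this (X.smul_mem t hxX))
  have hX'low : ∀ j, j < b → X' ⊓ d j ≤ A := fun j hj z hz =>
    hXX' ⟨hXlow j hj ⟨hX' hz.1, hz.2⟩, hz.1⟩
  -- Index j stands for the value j + 1: `T m` lists the values below m at which `d` does not grow
  -- inside B. All four rows are expressed through it.
  set T : ℕ → Finset ℕ := fun m =>
    (Finset.range (finrank K V)).filter fun j => j + 1 < m ∧ B ⊓ d (j + 1) ≤ d j with hT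
  have e1 : rotheRow d A X = (T a).card := by
    refine congrArg Finset.card (Finset.filter_congr fun j _ => ⟨fun h => ?_, fun h => ?_⟩)
    · have h1 : j + 1 < a := lt_of_not_ge fun h1 => hAup _ h1 (h.trans inf_le_left)
      exact ⟨h1, fun z hz => (h ⟨hXlow _ (h1.trans hlt) hz, hz.2⟩).2⟩
    · exact le_inf (hAlow _ h.1) ((inf_le_inf_right _ hX).trans h.2)
  have e2 : rotheRow d X B = (T b).card := by
    refine congrArg Finset.card (Finset.filter_congr fun j _ => ⟨fun h => ?_, fun h => ?_⟩)
    · exact ⟨lt_of_not_ge fun h1 => hXup _ h1 (h.trans inf_le_left), h.trans inf_le_right⟩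
    · exact le_inf (hXlow _ h.1) h.2
  have e3 : rotheRow d X' B = (T a).card := by
    refine congrArg Finset.card (Finset.filter_congr fun j _ => ⟨fun h => ?_, fun h => ?_⟩)
    · refine ⟨lt_of_not_ge fun h1 => hxX' ?_, h.trans inf_le_right⟩
      exact (h ⟨hX hxX, hd.mono h1 hxd⟩).1
    · exact le_inf (fun z hz => hA' (hAlow _ h.1 ⟨hXlow _ (h.1.trans hlt) hz, hz.2⟩)) h.2
  have hmem : a - 1 ∉ T b := by
    intro h
    have h1 := (Finset.mem_filter.1 h).2.2
    rw [Nat.sub_add_cancel hp] at h1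
    exact hxA (hAlow (a - 1) (by omega) ⟨hxX, h1 ⟨hX hxX, hxd⟩⟩)
  -- The step from A to X' jumps at b while the value a is now taken only later; index a - 1 is the
  -- new inversion.
  have e4 : rotheRow d A X' = (insert (a - 1) (T b)).card := by
    refine congrArg Finset.card (Finset.ext fun j => ?_)
    simp only [hT, Finset.mem_insert, Finset.mem_filter, Finset.mem_range]
    constructor
    · rintro ⟨hj, h⟩
      have h1 : j + 1 < b := lt_of_not_ge fun h1 => hX'A _ h1 (h.trans inf_le_left)
      by_cases hja : j + 1 = a
      · left; omega
      refine Or.inr ⟨hj, h1, fun z hz => ?_⟩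
      have hzX := hXlow _ h1 hz
      rcases lt_or_gt_of_ne hja with h2 | h2
      · exact (h ⟨hA' (hAlow _ h2 ⟨hzX, hz.2⟩), hz.2⟩).2
      · obtain ⟨t, ht⟩ := mem_of_covBy hAX hxX hxA hzX
        have hxj : x ∈ d j := hd.mono (by omega) hxd
        have h3 := (h ⟨hA' ht, Submodule.sub_mem _ hz.2
          (Submodule.smul_mem _ t (hd.mono (Nat.le_succ j) hxj))⟩).2
        simpa using Submodule.add_mem _ h3 (Submodule.smul_mem _ t hxj)
    · rintro (rfl | ⟨hj, h1, h⟩)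
      · refine ⟨by omega, ?_⟩
        rw [Nat.sub_add_cancel hp]
        refine le_inf (hX'low _ hlt) fun z hz => ?_
        have hzA := hX'low _ hlt hz
        obtain ⟨t, ht⟩ := hx z hz.2
        by_cases ht0 : t = 0
        · simpa [ht0] using ht
        · have h2 := hAlow (a - 1) (by omega) ⟨X.sub_mem (hA hzA) (X.smul_mem t hxX), ht⟩
          have h3 := A.sub_mem hzA h2
          rw [sub_sub_cancel] at h3
          exact absurd ((A.smul_mem_iff ht0).1 h3) hxA
      · exact ⟨hj, le_inf (hX'low _ h1) ((inf_le_inf_right _ hX').trans h)⟩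
  rw [e1, e2, e3, e4, Finset.card_insert_of_notMem hmem]
  omega

/-- The ascending L attains the least value, and every other intermediate subspace gives exactly one
more. -/
theorem rotheRow_add_le (hd : IsFullFlag d) (hAX : A ⋖ X) (hXB : X ⋖ B) (hAX' : A ⋖ X')
    (hX'B : X' ⋖ B) :
    rotheRow d A X + rotheRow d X B ≤ rotheRow d A X' + rotheRow d X' B + 1 := by
  obtain ⟨L, h1, h2, h3⟩ := hd.exists_ascending hAX hXB
  have key : ∀ Y, A ⋖ Y → Y ⋖ B → Y = L ∨
      rotheRow d A Y + rotheRow d Y B = rotheRow d A L + rotheRow d L B + 1 := fun Y hY hY' =>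
    or_iff_not_imp_left.2 fun hne => hd.rotheRow_swap h1 h2 hY hY' hne h3
  rcases key X hAX hXB with rfl | h
  · rcases key X' hAX' hX'B with rfl | h'
    · omega
    · omega
  · rcases key X' hAX' hX'B with rfl | h'
    · omega
    · omega

end IsFullFlag

end RelativePosition

/-! ### Distance in the chamber graph, and opposite flags. -/

section Opposition

variable {K V : Type*} [DivisionRing K] [AddCommGroup V] [Module K V] [FiniteDimensional K V]

omit [FiniteDimensional K V] in
theorem flagLength_add_eq {c c' : ℕ → Submodule K V} (d : ℕ → Submodule K V) {i : ℕ}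
    (hi : i + 1 < finrank K V) (h : ∀ k, k ≠ i + 1 → c k = c' k) :
    flagLength c d + (rotheRow d (c' i) (c' (i + 1)) + rotheRow d (c' (i + 1)) (c' (i + 2))) =
      flagLength c' d + (rotheRow d (c i) (c (i + 1)) + rotheRow d (c (i + 1)) (c (i + 2))) := by
  have key : ∀ e : ℕ → Submodule K V, flagLength e d =
      rotheRow d (e i) (e (i + 1)) + (rotheRow d (e (i + 1)) (e (i + 2)) +
        ∑ k ∈ ((Finset.range (finrank K V)).erase i).erase (i + 1),
          rotheRow d (e k) (e (k + 1))) := by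
    intro e
    rw [flagLength, ← Finset.add_sum_erase (Finset.range (finrank K V)) _
      (Finset.mem_range.2 (by omega : i < finrank K V)), ← Finset.add_sum_erase _ _
      (Finset.mem_erase.2 ⟨by omega, Finset.mem_range.2 hi⟩ :
        i + 1 ∈ (Finset.range (finrank K V)).erase i)]
  have hs : ∑ k ∈ ((Finset.range (finrank K V)).erase i).erase (i + 1),
      rotheRow d (c k) (c (k + 1)) =
      ∑ k ∈ ((Finset.range (finrank K V)).erase i).erase (i + 1),
        rotheRow d (c' k) (c' (k + 1)) := by
    refine Finset.sum_congr rfl fun k hk => ?_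
    simp only [Finset.mem_erase] at hk
    rw [h k hk.1, h (k + 1) (by omega)]
  rw [key c, key c', hs]
  omega

namespace IsFullFlag

variable {c d : ℕ → Submodule K V}

theorem update (hc : IsFullFlag c) {i : ℕ} (hi : i + 1 < finrank K V) {X : Submodule K V}
    (h1 : c i ⋖ X) (h2 : X ⋖ c (i + 2)) : IsFullFlag (Function.update c (i + 1) X) := by
  refine IsFullFlag.of_step (fun k _ => ?_) fun k => ?_
  · by_cases hk : k = i + 1
    · subst hk
      rw [Function.update_self, Function.update_of_ne (by omega)]
      exact h2.le
    · by_cases hk' : k = i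
      · subst hk'
        rw [Function.update_self, Function.update_of_ne (by omega)]
        exact h1.le
      · rw [Function.update_of_ne hk, Function.update_of_ne (by omega)]
        exact hc.mono k.le_succ
  · by_cases hk : k = i + 1
    · subst hk
      rw [Function.update_self, finrank_of_covBy h1, hc.finrank_eq]
      omega
    · rw [Function.update_of_ne hk, hc.finrank_eq]

theorem adj_update (hc : IsFullFlag c) {i : ℕ} (hi : i + 1 < finrank K V) {X : Submodule K V}
    (h1 : c i ⋖ X) (h2 : X ⋖ c (i + 2)) (hne : X ≠ c (i + 1)) :
    (chamberGraph K V).Adj hc.chamber (hc.update hi h1 h2).chamber :=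
  hc.adj_of_eq _ (i := i + 1) (by rw [Function.update_self]; exact hne.symm)
    fun k hk => (Function.update_of_ne hk _ _).symm

omit [FiniteDimensional K V] in
theorem flagLength_update {i : ℕ} (hi : i + 1 < finrank K V)
    {X : Submodule K V} :
    flagLength c d + (rotheRow d (c i) X + rotheRow d X (c (i + 2))) =
      flagLength (Function.update c (i + 1) X) d +
        (rotheRow d (c i) (c (i + 1)) + rotheRow d (c (i + 1)) (c (i + 2))) := by
  have := flagLength_add_eq (c := c) (c' := Function.update c (i + 1) X) d hi
    fun k hk => (Function.update_of_ne hk _ _).symm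
  rwa [Function.update_self, Function.update_of_ne (by omega),
    Function.update_of_ne (by omega)] at this

theorem flagLength_self (hd : IsFullFlag d) : flagLength d d = 0 := by
  classical
  refine Finset.sum_eq_zero fun i hi => ?_
  rw [Finset.mem_range] at hi
  refine Finset.card_eq_zero.2 (Finset.filter_eq_empty_iff.2 fun j hj h => ?_)
  rw [Finset.mem_range] at hj
  rcases le_total i j with hij | hij
  · rw [inf_eq_left.2 (hd.mono (by omega : i + 1 ≤ j + 1))] at h
    exact (hd.covBy hi).lt.not_ge (h.trans inf_le_left)
  · rw [inf_eq_right.2 (hd.mono (by omega : j + 1 ≤ i + 1))] at h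
    exact (hd.covBy hj).lt.not_ge (h.trans inf_le_right)

/-- Increasing jumps that start at 1 or later satisfy `i + 1 ≤ jump d (c i) (c (i + 1))`. So `d i`
stays inside the members of `c` while these descend from ⊤ to `c i`, and dimensions agree. -/
theorem eq_of_forall_ascending (hc : IsFullFlag c) (hd : IsFullFlag d)
    (h : ∀ i, i + 1 < finrank K V →
      jump d (c i) (c (i + 1)) < jump d (c (i + 1)) (c (i + 2))) : c = d := by
  have h1 : ∀ i, i < finrank K V → i + 1 ≤ jump d (c i) (c (i + 1)) := by
    intro i
    induction i with
    | zero => exact fun hi => hd.jump_pos (hc.covBy hi).lt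
    | succ i ih =>
      intro hi
      have := ih (by omega)
      exact Nat.succ_le_of_lt (lt_of_le_of_lt this (h i hi))
  refine hc.ext_of_lt hd fun i _ hi => ?_
  have h2 : ∀ k, k ≤ finrank K V - i → d i ≤ c (finrank K V - k) := by
    intro k
    induction k with
    | zero =>
      intro _
      rw [hc.top (by omega)]
      exact le_top
    | succ k ih =>
      intro hk
      have h3 := ih (by omega)
      have h4 : c (finrank K V - (k + 1) + 1) ⊓ d i ≤ c (finrank K V - (k + 1)) := by
        apply le_of_lt_jump
        have := h1 (finrank K V - (k + 1)) (by omega)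
        omega
      rw [show finrank K V - (k + 1) + 1 = finrank K V - k by omega] at h4
      exact (le_inf h3 le_rfl).trans h4
  have h3 := h2 (finrank K V - i) le_rfl
  rw [show finrank K V - (finrank K V - i) = i by omega] at h3
  exact (Submodule.eq_of_le_of_finrank_eq h3 (by rw [hc.finrank_eq, hd.finrank_eq])).symm

/-- Jumps are distinct, so they decrease strictly, and counting back from the last step bounds them
below. The intersection is therefore pushed down through all members of `c` to ⊥. -/
theorem inf_eq_bot_of_forall_descending (hc : IsFullFlag c) (hd : IsFullFlag d)
    (h : ∀ i, i + 1 < finrank K V →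
      jump d (c (i + 1)) (c (i + 2)) ≤ jump d (c i) (c (i + 1))) {i : ℕ}
    (hi : i ≤ finrank K V) : c i ⊓ d (finrank K V - i) = ⊥ := by
  have h1 : ∀ k, k < finrank K V → k + 1 ≤
      jump d (c (finrank K V - (k + 1))) (c (finrank K V - k)) := by
    intro k
    induction k with
    | zero =>
      intro hk
      have h0 := hc.covBy (i := finrank K V - 1) (by omega)
      rw [show finrank K V - 1 + 1 = finrank K V by omega] at h0
      exact hd.jump_pos h0.lt
    | succ k ih =>
      intro hk
      have h2 := ih (by omega)
      have h3 := h (finrank K V - (k + 2)) (by omega)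
      have h4 := hc.covBy (i := finrank K V - (k + 2)) (by omega)
      have h5 := hc.covBy (i := finrank K V - (k + 2) + 1) (by omega)
      have h6 := hd.jump_ne h4.lt h5.lt
      simp only [show finrank K V - (k + 2) + 2 = finrank K V - k by omega,
        show finrank K V - (k + 2) + 1 = finrank K V - (k + 1) by omega,
        show finrank K V - (k + 1) + 1 = finrank K V - k by omega, add_assoc,
        Nat.reduceAdd] at h2 h3 h6 ⊢
      omega
  have h2 : ∀ m, m ≤ i → c i ⊓ d (finrank K V - i) ≤ c (i - m) := by
    intro m
    induction m with
    | zero => exact fun _ => inf_le_left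
    | succ m ih =>
      intro hm
      have h3 := h1 (finrank K V - (i - m)) (by omega)
      rw [show finrank K V - (finrank K V - (i - m) + 1) = i - (m + 1) by omega,
        show finrank K V - (finrank K V - (i - m)) = i - m by omega] at h3
      exact (le_inf (ih (by omega)) inf_le_right).trans
        (le_of_lt_jump (j := finrank K V - i) (by omega))
  have h3 := h2 i le_rfl
  rw [Nat.sub_self, hc.bot] at h3
  exact le_bot_iff.1 h3

theorem exists_flagLength_add_one (hc : IsFullFlag c) (hd : IsFullFlag d) (hne : c ≠ d) :
    ∃ c', ∃ hc' : IsFullFlag c', (chamberGraph K V).Adj hc.chamber hc'.chamber ∧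
      flagLength c' d + 1 = flagLength c d := by
  have h : ∃ i, i + 1 < finrank K V ∧
      ¬ jump d (c i) (c (i + 1)) < jump d (c (i + 1)) (c (i + 2)) := by
    by_contra! h
    exact hne (hc.eq_of_forall_ascending hd h)
  obtain ⟨i, hi, hj⟩ := h
  have h1 := hc.covBy (i := i) (by omega)
  have h2 := hc.covBy hi
  obtain ⟨L, hL1, hL2, hL⟩ := hd.exists_ascending h1 h2
  have hneL : c (i + 1) ≠ L := by
    rintro rfl
    exact hj hL
  refine ⟨_, hc.update hi hL1 hL2, hc.adj_update hi hL1 hL2 hneL.symm, ?_⟩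
  have h3 := hd.rotheRow_swap hL1 hL2 h1 h2 hneL hL
  have h4 := flagLength_update (c := c) (d := d) hi (X := L)
  simp only [add_assoc, Nat.reduceAdd] at h3 h4 ⊢
  omega

theorem exists_eq_flagLength_add_one (hc : IsFullFlag c) (hd : IsFullFlag d) {j : ℕ}
    (hj : j ≤ finrank K V) (hne : c j ⊓ d (finrank K V - j) ≠ ⊥) :
    ∃ c', IsFullFlag c' ∧ flagLength c' d = flagLength c d + 1 := by
  have h : ∃ i, i + 1 < finrank K V ∧
      jump d (c i) (c (i + 1)) < jump d (c (i + 1)) (c (i + 2)) := by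
    by_contra! h
    exact hne (hc.inf_eq_bot_of_forall_descending hd h hj)
  obtain ⟨i, hi, hj⟩ := h
  have h1 := hc.covBy (i := i) (by omega)
  have h2 := hc.covBy hi
  obtain ⟨X, hX, hX1, hX2⟩ := exists_ne_covBy h1 h2
  refine ⟨_, hc.update hi hX1 hX2, ?_⟩
  have h3 := hd.rotheRow_swap h1 h2 hX1 hX2 hX hj
  have h4 := flagLength_update (c := c) (d := d) hi (X := X)
  simp only [add_assoc, Nat.reduceAdd] at h3 h4 ⊢
  omega

theorem exists_walk (hd : IsFullFlag d) (m : ℕ) : ∀ {c : ℕ → Submodule K V} (hc : IsFullFlag c),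
    flagLength c d = m → ∃ p : (chamberGraph K V).Walk hc.chamber hd.chamber, p.length ≤ m := by
  induction m with
  | zero =>
    intro c hc h
    by_cases hcd : c = d
    · subst hcd
      exact ⟨.nil, le_rfl⟩
    · obtain ⟨c', hc', hadj, hl⟩ := hc.exists_flagLength_add_one hd hcd
      omega
  | succ m ih =>
    intro c hc h
    by_cases hcd : c = d
    · subst hcd
      exact ⟨.nil, Nat.zero_le _⟩
    · obtain ⟨c', hc', hadj, hl⟩ := hc.exists_flagLength_add_one hd hcd
      obtain ⟨p, hp⟩ := ih hc' (by omega)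
      exact ⟨.cons hadj p, by simpa using hp⟩

theorem flagLength_le_of_adj {c' : ℕ → Submodule K V} (hc : IsFullFlag c) (hc' : IsFullFlag c')
    (hd : IsFullFlag d) (h : (chamberGraph K V).Adj hc.chamber hc'.chamber) :
    flagLength c d ≤ flagLength c' d + 1 := by
  obtain ⟨i, -, h1, h2, h3⟩ := hc.eq_of_adj hc' h
  obtain ⟨i, rfl⟩ := Nat.exists_eq_add_of_le' h1
  have h4 := flagLength_add_eq d h2 h3
  have h5 := hd.rotheRow_add_le (hc.covBy (i := i) (by omega)) (hc.covBy h2)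
    (X' := c' (i + 1)) (by rw [h3 i (by omega)]; exact hc'.covBy (by omega))
    (by rw [h3 (i + 1 + 1) (by omega)]; exact hc'.covBy (by omega))
  rw [h3 i (by omega), h3 (i + 1 + 1) (by omega)] at h5
  rw [h3 i (by omega), h3 (i + 2) (by omega)] at h4
  simp only [add_assoc, Nat.reduceAdd] at h4 h5
  omega

theorem flagLength_le_length {C D : {C : Set (Vertex K V) // IsChamber C}}
    (p : (chamberGraph K V).Walk C D) : ∀ {c d : ℕ → Submodule K V} (hc : IsFullFlag c)
    (hd : IsFullFlag d), C = hc.chamber → D = hd.chamber → flagLength c d ≤ p.length := by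
  induction p with
  | nil =>
    intro c d hc hd h1 h2
    obtain rfl := hc.flagSet_injective hd (congrArg Subtype.val (h1.symm.trans h2))
    rw [hc.flagLength_self]
    exact Nat.zero_le _
  | @cons _ E _ hadj p ih =>
    intro c d hc hd h1 h2
    obtain ⟨e, he, hE⟩ := E.2.exists_isFullFlag
    obtain rfl : E = he.chamber := Subtype.ext hE
    subst h1
    have h3 := ih he hd rfl h2
    have h4 := hc.flagLength_le_of_adj he hd hadj
    rw [SimpleGraph.Walk.length_cons]
    omega

theorem dist_eq (hc : IsFullFlag c) (hd : IsFullFlag d) :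
    (chamberGraph K V).dist hc.chamber hd.chamber = flagLength c d := by
  obtain ⟨p, hp⟩ := hd.exists_walk _ hc rfl
  refine le_antisymm ((SimpleGraph.dist_le p).trans hp) ?_
  obtain ⟨q, hq⟩ := p.reachable.exists_walk_length_eq_dist
  rw [← hq]
  exact flagLength_le_length q hc hd rfl rfl

theorem finrank_inf_ge (hc : IsFullFlag c) (hd : IsFullFlag d) {i j : ℕ}
    (hi : i ≤ finrank K V) (hj : j ≤ finrank K V) :
    i + j ≤ finrank K V + finrank K (c i ⊓ d j : Submodule K V) := by
  have h := Submodule.finrank_sup_add_finrank_inf_eq (c i) (d j)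
  have h1 := Submodule.finrank_le (c i ⊔ d j)
  rw [hc.finrank_eq, hd.finrank_eq] at h
  omega

theorem sup_eq_top (hc : IsFullFlag c) (hd : IsFullFlag d) {i : ℕ} (hi : i ≤ finrank K V)
    (h : c i ⊓ d (finrank K V - i) = ⊥) : c i ⊔ d (finrank K V - i) = ⊤ := by
  apply Submodule.eq_top_of_finrank_eq
  have := Submodule.finrank_sup_add_finrank_inf_eq (c i) (d (finrank K V - i))
  rw [h, finrank_bot, hc.finrank_eq, hd.finrank_eq] at this
  omega

/-- The point is that the right side depends on the dimension only, so all complementary pairs have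
the same length. -/
theorem flagLength_of_inf_eq_bot (hc : IsFullFlag c) (hd : IsFullFlag d)
    (h : ∀ i ≤ finrank K V, c i ⊓ d (finrank K V - i) = ⊥) :
    flagLength c d = ∑ i ∈ Finset.range (finrank K V),
      ((Finset.range (finrank K V)).filter fun j => i + j + 2 ≤ finrank K V).card := by
  classical
  refine Finset.sum_congr rfl fun i hi => congrArg Finset.card ?_
  rw [Finset.mem_range] at hi
  ext j
  simp only [Finset.mem_filter, Finset.mem_range, and_congr_right_iff]
  intro hj
  constructor
  · intro hle
    by_contra hlt
    have h1 := hc.finrank_inf_ge hd (i := i + 1) (j := j + 1) (by omega) (by omega)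
    have h2 := Submodule.finrank_mono hle
    rcases le_or_gt (i + j) (finrank K V) with hij | hij
    · have h3 : c i ⊓ d j = ⊥ := le_bot_iff.1
        ((inf_le_inf_left _ (hd.mono (by omega))).trans (h i (by omega)).le)
      rw [h3, finrank_bot] at h2
      omega
    · have h3 : c i ⊔ d j = ⊤ := top_le_iff.1 ((hc.sup_eq_top hd hi.le (h i hi.le)).ge.trans
        (sup_le_sup_left (hd.mono (by omega)) _))
      have h4 := Submodule.finrank_sup_add_finrank_inf_eq (c i) (d j)
      rw [h3, finrank_top, hc.finrank_eq, hd.finrank_eq] at h4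
      omega
  · intro hle
    have h3 : c (i + 1) ⊓ d (j + 1) ≤ ⊥ :=
      (inf_le_inf_left _ (hd.mono (by omega))).trans (h (i + 1) (by omega)).le
    exact h3.trans bot_le

omit [FiniteDimensional K V] in
theorem flagLength_le (c d : ℕ → Submodule K V) :
    flagLength c d ≤ finrank K V * finrank K V := by
  classical
  have : ∀ i ∈ Finset.range (finrank K V), rotheRow d (c i) (c (i + 1)) ≤ finrank K V :=
    fun i _ => (Finset.card_filter_le _ _).trans (Finset.card_range _).le
  simpa [flagLength] using Finset.sum_le_card_nsmul _ _ _ this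

/-- Two chambers are opposite if and only if complementary members of their flags are
complements of each other. -/
theorem oppositeChambers_iff (hc : IsFullFlag c) (hd : IsFullFlag d) :
    OppositeChambers hc.chamber hd.chamber ↔
      ∀ i ≤ finrank K V, c i ⊓ d (finrank K V - i) = ⊥ := by
  have hmax : ∀ {c d : ℕ → Submodule K V}, IsFullFlag c → IsFullFlag d →
      (∀ a b : ℕ → Submodule K V, IsFullFlag a → IsFullFlag b →
        flagLength a b ≤ flagLength c d) →
      ∀ i ≤ finrank K V, c i ⊓ d (finrank K V - i) = ⊥ := by
    intro c d hc hd h i hi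
    by_contra hne
    obtain ⟨c', hc', hl⟩ := hc.exists_eq_flagLength_add_one hd hi hne
    have := h c' d hc' hd
    omega
  constructor
  · intro h
    refine hmax hc hd fun a b ha hb => ?_
    rw [← ha.dist_eq hb, ← hc.dist_eq hd]
    exact h _ _
  · rintro h ⟨A, hA⟩ ⟨B, hB⟩
    obtain ⟨a, ha, rfl⟩ := hA.exists_isFullFlag
    obtain ⟨b, hb, rfl⟩ := hB.exists_isFullFlag
    change (chamberGraph K V).dist ha.chamber hb.chamber ≤ _
    rw [ha.dist_eq hb, hc.dist_eq hd]
    -- Lengths are bounded, so some pair attains the greatest one. By `hmax` it is complementary,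
    -- hence has the same length as the given pair.
    obtain ⟨m, ⟨x, y, hx, hy, rfl⟩, hm⟩ := BddAbove.exists_isGreatest_of_nonempty
      (S := {m | ∃ x y : ℕ → Submodule K V, IsFullFlag x ∧ IsFullFlag y ∧ flagLength x y = m})
      ⟨finrank K V * finrank K V, by rintro _ ⟨x, y, -, -, rfl⟩; exact flagLength_le x y⟩
      ⟨_, a, b, ha, hb, rfl⟩
    have hm' : ∀ a b : ℕ → Submodule K V, IsFullFlag a → IsFullFlag b →
        flagLength a b ≤ flagLength x y := fun a b ha hb => hm ⟨a, b, ha, hb, rfl⟩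
    refine (hm' a b ha hb).trans ?_
    rw [hx.flagLength_of_inf_eq_bot hy (hmax hx hy hm'), hc.flagLength_of_inf_eq_bot hd h]

/-- A flag `a` that is complementary to a flag `d` in the dimensions from `J` has an opposite flag
that agrees with `d` in the complementary dimensions. -/
theorem exists_opposite (ha : IsFullFlag c) (hd : IsFullFlag d) (J : Set ℕ)
    (hJ : ∀ k ∈ J, k ≤ finrank K V → c k ⊓ d (finrank K V - k) = ⊥) :
    ∃ b : ℕ → Submodule K V, IsFullFlag b ∧
      (∀ i ≤ finrank K V, c i ⊓ b (finrank K V - i) = ⊥) ∧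
      ∀ k ∈ J, k ≤ finrank K V → b (finrank K V - k) = d (finrank K V - k) := by
  have step : ∀ i, i < finrank K V → ∀ F : Submodule K V, finrank K F = finrank K V - i →
      c i ⊓ F = ⊥ → (∀ k ∈ J, i ≤ k → k ≤ finrank K V → d (finrank K V - k) ≤ F) →
      ∃ G : Submodule K V, G ≤ F ∧ finrank K G = finrank K V - (i + 1) ∧ c (i + 1) ⊓ G = ⊥ ∧
        ∀ k ∈ J, i + 1 ≤ k → k ≤ finrank K V → d (finrank K V - k) ≤ G := by
    intro i hi F hF hbot hdF
    -- E is the largest prescribed member of `d` still to be contained, belonging to the least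
    -- remaining k in J, or ⊥ if none remains.
    have hE : ∃ E : Submodule K V, E ≤ F ∧ c (i + 1) ⊓ E = ⊥ ∧
        ∀ k ∈ J, i + 1 ≤ k → k ≤ finrank K V → d (finrank K V - k) ≤ E := by
      by_cases hex : ∃ k, k ∈ J ∧ i + 1 ≤ k ∧ k ≤ finrank K V
      · classical
        obtain ⟨h1, h2, h3⟩ := Nat.find_spec hex
        refine ⟨d (finrank K V - Nat.find hex), hdF _ h1 (by omega) h3, ?_, ?_⟩
        · exact le_bot_iff.1 ((inf_le_inf_right _ (ha.mono h2)).trans (hJ _ h1 h3).le)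
        · intro k hk hk1 hk2
          have := Nat.find_min' hex ⟨hk, hk1, hk2⟩
          exact hd.mono (by omega)
      · exact ⟨⊥, bot_le, inf_bot_eq _, fun k hk h1 h2 => (hex ⟨k, hk, h1, h2⟩).elim⟩
    obtain ⟨E, hEF, hEc, hE⟩ := hE
    have hdis : Disjoint E (F ⊓ c (i + 1)) := by
      rw [disjoint_iff, ← le_bot_iff, ← hEc]
      exact le_inf (inf_le_right.trans inf_le_right) inf_le_left
    -- A complement of `F ⊓ c (i + 1)` containing E, cut down to F, is a complement within F by the
    -- modular law. The removed part has dimension one.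
    obtain ⟨G, hEG, hG⟩ := hdis.exists_isCompl
    have hmod : F ⊓ c (i + 1) ⊔ G ⊓ F = F := by
      rw [← sup_inf_assoc_of_le _ (inf_le_left : F ⊓ c (i + 1) ≤ F), sup_comm,
        hG.sup_eq_top, top_inf_eq]
    have hint : F ⊓ c (i + 1) ⊓ (G ⊓ F) = ⊥ := by
      rw [← le_bot_iff, ← hG.inf_eq_bot]
      exact le_inf (inf_le_right.trans inf_le_left) inf_le_left
    have hf := Submodule.finrank_sup_add_finrank_inf_eq (F ⊓ c (i + 1)) (G ⊓ F)
    rw [hmod, hint, finrank_bot, hF] at hf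
    have hsup : c (i + 1) ⊔ F = ⊤ := by
      refine top_le_iff.1 (le_trans (le_of_eq ?_) (sup_le_sup_right (ha.mono i.le_succ) F))
      refine (Submodule.eq_top_of_finrank_eq ?_).symm
      have := Submodule.finrank_sup_add_finrank_inf_eq (c i) F
      rw [hbot, finrank_bot, ha.finrank_eq] at this
      omega
    have hf2 := Submodule.finrank_sup_add_finrank_inf_eq (c (i + 1)) F
    rw [hsup, finrank_top, ha.finrank_eq, inf_comm] at hf2
    refine ⟨G ⊓ F, inf_le_right, by omega, ?_, fun k hk h1 h2 =>
      le_inf ((hE k hk h1 h2).trans hEG) ((hE k hk h1 h2).trans hEF)⟩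
    rw [← le_bot_iff, ← hint]
    exact le_inf (le_inf (inf_le_right.trans inf_le_right) inf_le_left) inf_le_right
  have hall : ∀ m, m ≤ finrank K V → ∃ b : ℕ → Submodule K V,
      ∀ i ≤ m, finrank K (b i) = finrank K V - i ∧ c i ⊓ b i = ⊥ ∧
        (∀ k ∈ J, i ≤ k → k ≤ finrank K V → d (finrank K V - k) ≤ b i) ∧
        (i < m → b (i + 1) ≤ b i) := by
    intro m
    induction m with
    | zero =>
      intro _
      refine ⟨fun _ => ⊤, fun i hi => ?_⟩
      obtain rfl : i = 0 := by omega
      exact ⟨by simp, by rw [ha.bot, bot_inf_eq], fun _ _ _ _ => le_top, by omega⟩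
    | succ m ih =>
      intro hm
      obtain ⟨b, hb⟩ := ih (by omega)
      obtain ⟨h1, h2, h3, -⟩ := hb m le_rfl
      obtain ⟨G, hG1, hG2, hG3, hG4⟩ := step m (by omega) (b m) h1 h2 h3
      refine ⟨Function.update b (m + 1) G, fun i hi => ?_⟩
      rcases Nat.lt_or_ge i (m + 1) with h | h
      · obtain ⟨h4, h5, h6, h7⟩ := hb i (by omega)
        rw [Function.update_of_ne (by omega)]
        refine ⟨h4, h5, h6, fun _ => ?_⟩
        by_cases him : i = m
        · subst him
          rwa [Function.update_self]
        · rw [Function.update_of_ne (by omega)]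
          exact h7 (by omega)
      · obtain rfl : i = m + 1 := by omega
        rw [Function.update_self]
        exact ⟨hG2, hG3, hG4, by omega⟩
  obtain ⟨b, hb⟩ := hall _ le_rfl
  -- So far `b` was indexed by codimension.
  refine ⟨fun i => b (finrank K V - i), IsFullFlag.of_step (fun i hi => ?_) fun i => ?_,
    fun i hi => ?_, fun k hk hkN => ?_⟩
  · have := (hb (finrank K V - (i + 1)) (by omega)).2.2.2 (by omega)
    rwa [show finrank K V - (i + 1) + 1 = finrank K V - i by omega] at this
  · rw [(hb (finrank K V - i) (by omega)).1]
    omega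
  · beta_reduce
    rw [show finrank K V - (finrank K V - i) = i by omega]
    exact (hb i hi).2.1
  · beta_reduce
    rw [show finrank K V - (finrank K V - k) = k by omega]
    refine (Submodule.eq_of_le_of_finrank_eq ((hb k hkN).2.2.1 k hk le_rfl hkN) ?_).symm
    rw [(hb k hkN).1, hd.finrank_eq]
    omega

end IsFullFlag

end Opposition

/-! ### Nondegenerate flags for bilinear forms over 𝔽₂. -/

section BilinearForm

theorem zmodTwo_eq_one_of_ne_zero {a : ZMod 2} (h : a ≠ 0) : a = 1 := by
  revert a; decide

variable {V : Type*} [AddCommGroup V] [Module (ZMod 2) V]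

/-- The restriction of the bilinear form `B` to `U` is nondegenerate. -/
def NondegenerateOn (B : V →ₗ[ZMod 2] V →ₗ[ZMod 2] ZMod 2) (U : Submodule (ZMod 2) V) : Prop :=
  ∀ v ∈ U, (∀ u ∈ U, B u v = 0) → v = 0

/-- A complete flag of subspaces of `W`, constantly `W` from `dim W` on. -/
structure IsFlagOf (W : Submodule (ZMod 2) V) (c : ℕ → Submodule (ZMod 2) V) : Prop where
  mono : Monotone c
  finrank_eq : ∀ i, finrank (ZMod 2) (c i) = min i (finrank (ZMod 2) W)
  le : ∀ i, c i ≤ W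

/-- The flag obtained from `c` by adding the vector `x` to all members and prepending `⊥`. -/
def consFlag (x : V) (c : ℕ → Submodule (ZMod 2) V) : ℕ → Submodule (ZMod 2) V
  | 0 => ⊥
  | i + 1 => c i ⊔ (ZMod 2) ∙ x

theorem nondegenerateOn_bot (B : V →ₗ[ZMod 2] V →ₗ[ZMod 2] ZMod 2) : NondegenerateOn B ⊥ :=
  fun _ hv _ => (Submodule.mem_bot _).1 hv

variable {B : V →ₗ[ZMod 2] V →ₗ[ZMod 2] ZMod 2} {U W : Submodule (ZMod 2) V} {x : V}

theorem exists_smul_mem_inf_ker (hx : x ∈ W) (hxx : B x x = 1) {v : V} (hv : v ∈ W) :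
    v - B x v • x ∈ W ⊓ LinearMap.ker (B x) := by
  refine ⟨W.sub_mem hv (W.smul_mem _ hx), ?_⟩
  simp [hxx]

/-- Each u in W differs from a vector of the right perp of x by a multiple of x, and x itself pairs
to zero with that perp. -/
theorem NondegenerateOn.inf_ker (hW : NondegenerateOn B W) (hx : x ∈ W) (hxx : B x x = 1) :
    NondegenerateOn B (W ⊓ LinearMap.ker (B x)) := by
  rintro v ⟨hvW, hv⟩ h
  refine hW v hvW fun u hu => ?_
  have h1 := h _ (exists_smul_mem_inf_ker hx hxx hu)
  have hxv : B x v = 0 := hv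
  simpa [hxv] using h1

/-- Testing a radical vector u + a x against x gives a = 0, and then u lies in the radical of U.
One-sided orthogonality suffices; B u x may be nonzero. -/
theorem NondegenerateOn.sup_span (hU : NondegenerateOn B U) (hUx : U ≤ LinearMap.ker (B x))
    (hxx : B x x = 1) : NondegenerateOn B (U ⊔ (ZMod 2) ∙ x) := by
  intro v hv h
  obtain ⟨u, hu, w, hw, rfl⟩ := Submodule.mem_sup.1 hv
  obtain ⟨a, rfl⟩ := Submodule.mem_span_singleton.1 hw
  have hux : B x u = 0 := hUx hu
  have h1 := h x (Submodule.mem_sup_right (Submodule.mem_span_singleton_self x))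
  have ha : a = 0 := by simpa [hux, hxx] using h1
  subst ha
  have : u = 0 := hU u hu fun u' hu' => by simpa using h u' (Submodule.mem_sup_left hu')
  simp [this]

variable [FiniteDimensional (ZMod 2) V]

theorem finrank_le_finrank_inf_ker_add_one (U : Submodule (ZMod 2) V) (f : V →ₗ[ZMod 2] ZMod 2) :
    finrank (ZMod 2) U ≤ finrank (ZMod 2) (U ⊓ LinearMap.ker f : Submodule (ZMod 2) V) + 1 := by
  have h1 := Submodule.finrank_sup_add_finrank_inf_eq U (LinearMap.ker f)
  have h2 := f.finrank_range_add_finrank_ker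
  have h3 := Submodule.finrank_le (LinearMap.range f)
  have h4 := Submodule.finrank_le (U ⊔ LinearMap.ker f)
  rw [finrank_self] at h3
  omega

theorem finrank_inf_ker_add_one (hx : x ∈ W) (hxx : B x x = 1) :
    finrank (ZMod 2) (W ⊓ LinearMap.ker (B x) : Submodule (ZMod 2) V) + 1 =
      finrank (ZMod 2) W := by
  refine le_antisymm ?_ (finrank_le_finrank_inf_ker_add_one _ _)
  refine Submodule.finrank_lt_finrank_of_lt (lt_of_le_of_ne inf_le_left fun h => ?_)
  have h1 : x ∈ W ⊓ LinearMap.ker (B x) := by rw [h]; exact hx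
  have h2 : B x x = 0 := h1.2
  exact one_ne_zero (hxx.symm.trans h2)

namespace IsFlagOf

variable {c : ℕ → Submodule (ZMod 2) V}

theorem cons (hc : IsFlagOf (W ⊓ LinearMap.ker (B x)) c) (hx : x ∈ W) (hxx : B x x = 1) :
    IsFlagOf W (consFlag x c) := by
  refine ⟨monotone_nat_of_le_succ fun i => ?_, fun i => ?_, fun i => ?_⟩
  · cases i with
    | zero => exact bot_le
    | succ i => exact sup_le_sup_right (hc.mono i.le_succ) _
  · cases i with
    | zero => exact (finrank_bot _ _).trans (Nat.zero_min _).symm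
    | succ i =>
      have hxc : x ∉ c i := fun h => by
        have : B x x = 0 := (hc.le i h).2
        rw [hxx] at this
        exact one_ne_zero this
      rw [consFlag, finrank_sup_span_singleton hxc, hc.finrank_eq, ← finrank_inf_ker_add_one hx hxx]
      omega
  · cases i with
    | zero => exact bot_le
    | succ i => exact sup_le ((hc.le i).trans inf_le_left) (by simpa using hx)

omit [FiniteDimensional (ZMod 2) V] in
theorem snoc {H : Submodule (ZMod 2) V} (hc : IsFlagOf H c) (hHW : H ≤ W)
    (hf : finrank (ZMod 2) H + 1 = finrank (ZMod 2) W) :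
    IsFlagOf W fun i => if i < finrank (ZMod 2) W then c i else W := by
  refine ⟨fun i j hij => ?_, fun i => ?_, fun i => ?_⟩
  · split_ifs with h1 h2 h2
    · exact hc.mono hij
    · exact (hc.le i).trans hHW
    · omega
    · exact le_rfl
  · by_cases h1 : i < finrank (ZMod 2) W
    · rw [show (if i < finrank (ZMod 2) W then c i else W) = c i from if_pos h1, hc.finrank_eq]
      omega
    · rw [show (if i < finrank (ZMod 2) W then c i else W) = W from if_neg h1]
      omega
  · split_ifs with h1
    · exact (hc.le i).trans hHW
    · exact le_rfl

omit [FiniteDimensional (ZMod 2) V] in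
theorem consFlag_nondegenerateOn (hc : IsFlagOf (W ⊓ LinearMap.ker (B x)) c) (hxx : B x x = 1)
    {i : ℕ} (h : ∀ j, i = j + 1 → NondegenerateOn B (c j)) :
    NondegenerateOn B (consFlag x c i) := by
  cases i with
  | zero => exact nondegenerateOn_bot B
  | succ i => exact (h i rfl).sup_span ((hc.le i).trans inf_le_right) hxx

end IsFlagOf

theorem exists_inf_ker_not_alternating (hW : NondegenerateOn B W)
    (hf : 4 ≤ finrank (ZMod 2) W) (hx : x ∈ W) (hxx : B x x = 1) :
    ∃ y ∈ W, B y y = 1 ∧ ∃ v ∈ W ⊓ LinearMap.ker (B y), B v v = 1 := by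
  by_cases halt : ∃ v ∈ W ⊓ LinearMap.ker (B x), B v v = 1
  · exact ⟨x, hx, hxx, halt⟩
  have halt' : ∀ v ∈ W ⊓ LinearMap.ker (B x), B v v = 0 := fun v hv => by
    by_contra h
    exact halt ⟨v, hv, zmodTwo_eq_one_of_ne_zero h⟩
  have hH := hW.inf_ker hx hxx
  have hfH := finrank_inf_ker_add_one hx hxx
  set H := W ⊓ LinearMap.ker (B x) with hHdef
  have hfK := finrank_le_finrank_inf_ker_add_one H (B.flip x)
  -- Let K be the intersection of H with the left perp of x; its dimension is at least two. If B
  -- vanished on K, then, with z spanning H modulo K, a nonzero v in K with B z v = 0 would be in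
  -- the radical of H.
  have hwu : ∃ w ∈ H ⊓ LinearMap.ker (B.flip x), ∃ u ∈ H ⊓ LinearMap.ker (B.flip x),
      B w u = 1 := by
    by_contra! hno
    have hno' : ∀ w ∈ H ⊓ LinearMap.ker (B.flip x), ∀ u ∈ H ⊓ LinearMap.ker (B.flip x),
        B w u = 0 := fun w hw u hu => by
      by_contra h
      exact hno w hw u hu (zmodTwo_eq_one_of_ne_zero h)
    have hz : ∃ z, ∀ w ∈ H, ∃ a : ZMod 2, w - a • z ∈ H ⊓ LinearMap.ker (B.flip x) := by
      by_cases h : ∃ z ∈ H, B z x = 1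
      · obtain ⟨z, hzH, hz⟩ := h
        refine ⟨z, fun w hw => ⟨B w x, H.sub_mem hw (H.smul_mem _ hzH), ?_⟩⟩
        simp [hz]
      · refine ⟨0, fun w hw => ⟨0, ?_⟩⟩
        rw [smul_zero, sub_zero]
        refine ⟨hw, ?_⟩
        by_contra h'
        exact h ⟨w, hw, zmodTwo_eq_one_of_ne_zero h'⟩
    obtain ⟨z, hz⟩ := hz
    have hfz := finrank_le_finrank_inf_ker_add_one (H ⊓ LinearMap.ker (B.flip x)) (B z)
    have hne : H ⊓ LinearMap.ker (B.flip x) ⊓ LinearMap.ker (B z) ≠ ⊥ := by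
      intro h
      rw [h, finrank_bot] at hfz
      omega
    obtain ⟨v, ⟨hvK, hvz⟩, hv0⟩ := Submodule.exists_mem_ne_zero_of_ne_bot hne
    refine hv0 (hH v hvK.1 fun w hw => ?_)
    obtain ⟨a, ha⟩ := hz w hw
    have h1 := hno' _ ha v hvK
    have h2 : B z v = 0 := hvz
    simpa [h2] using h1
  obtain ⟨w, ⟨hwH, hwx⟩, u, ⟨huH, hux⟩, hwu⟩ := hwu
  have e1 : B x w = 0 := hwH.2
  have e2 : B w x = 0 := hwx
  have e3 : B x u = 0 := huH.2
  have e4 : B u x = 0 := hux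
  -- Both sums have value 1 because H is alternating and all mixed terms with x vanish. They are
  -- orthogonal because B x x + B w u = 1 + 1 = 0.
  refine ⟨x + w, W.add_mem hx hwH.1, ?_, x + u, ⟨W.add_mem hx huH.1, ?_⟩, ?_⟩
  · simp [e1, e2, hxx, halt' w hwH]
  · change B (x + w) (x + u) = 0
    simp only [map_add, LinearMap.add_apply, hxx, e3, e2, hwu]
    decide
  · simp [e3, e4, hxx, halt' u huH]

/-- A nondegenerate and non-alternating space over `𝔽₂` of dimension at least three without
complete flags of nondegenerate subspaces has, for each dimension `s`, a complete flag in which only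
the subspace of dimension `s` is degenerate. -/
theorem exists_flag_nondegenerateOn_of_ne (m : ℕ) : ∀ W : Submodule (ZMod 2) V,
    finrank (ZMod 2) W = m + 2 → NondegenerateOn B W → (1 ≤ m → ∃ x ∈ W, B x x = 1) →
    (¬ ∃ c, IsFlagOf W c ∧ ∀ i, NondegenerateOn B (c i)) →
    ∀ s, 1 ≤ s → s < m + 2 → ∃ c, IsFlagOf W c ∧ ∀ i, i ≠ s → NondegenerateOn B (c i) := by
  induction m with
  | zero =>
    intro W hf hW _ _ s hs hs2
    obtain rfl : s = 1 := by omega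
    -- Here only ⊥ and W have to be nondegenerate, so any one-dimensional p serves.
    obtain ⟨p, -, hpW, hp⟩ := exists_finrank_between (bot_le : ⊥ ≤ W) (d := 1)
      (by rw [finrank_bot]; omega) (by omega)
    refine ⟨fun i => if i < finrank (ZMod 2) W then (if i = 0 then ⊥ else p) else W,
      IsFlagOf.snoc (H := p) ⟨fun i j hij => ?_, fun i => ?_, fun i => ?_⟩ hpW (by omega),
      fun i hi => ?_⟩
    · split_ifs with h1 h2
      · exact le_rfl
      · exact bot_le
      · omega
      · exact le_rfl
    · by_cases h1 : i = 0
      · rw [show (if i = 0 then ⊥ else p) = ⊥ from if_pos h1, finrank_bot]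
        omega
      · rw [show (if i = 0 then ⊥ else p) = p from if_neg h1]
        omega
    · split_ifs with h1
      · exact bot_le
      · exact le_rfl
    · beta_reduce
      split_ifs with h1 h2
      · exact nondegenerateOn_bot B
      · omega
      · exact hW
  | succ m ih =>
    intro W hf hW hx hdom s hs hs2
    have hy : ∃ y ∈ W, B y y = 1 ∧ (1 ≤ m → ∃ v ∈ W ⊓ LinearMap.ker (B y), B v v = 1) := by
      obtain ⟨x, hxW, hxx⟩ := hx (by omega)
      by_cases hm : 1 ≤ m
      · obtain ⟨y, hyW, hyy, hv⟩ := exists_inf_ker_not_alternating hW (by omega) hxW hxx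
        exact ⟨y, hyW, hyy, fun _ => hv⟩
      · exact ⟨x, hxW, hxx, fun h => (hm h).elim⟩
    obtain ⟨y, hyW, hyy, hv⟩ := hy
    have hfy := finrank_inf_ker_add_one hyW hyy
    have ih' := ih (W ⊓ LinearMap.ker (B y)) (by omega) (hW.inf_ker hyW hyy) hv (by
      rintro ⟨c, hc, hcn⟩
      exact hdom ⟨_, hc.cons hyW hyy, fun i =>
        hc.consFlag_nondegenerateOn hyy fun j _ => hcn j⟩)
    -- Append W to a flag of the perp of y when s = 1; otherwise add y to all members of such a
    -- flag, which shifts the exceptional dimension from s - 1 to s.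
    by_cases hs1 : s = 1
    · subst hs1
      obtain ⟨c, hc, hcn⟩ := ih' 1 le_rfl (by omega)
      refine ⟨_, hc.snoc inf_le_left hfy, fun i hi => ?_⟩
      split_ifs with h
      · exact hcn i hi
      · exact hW
    · obtain ⟨c, hc, hcn⟩ := ih' (s - 1) (by omega) (by omega)
      exact ⟨_, hc.cons hyW hyy, fun i hi => hc.consFlag_nondegenerateOn hyy fun j hj =>
        hcn j (by omega)⟩

end BilinearForm

/-! ### The type permutation induced by a duality. -/

section TypePermutation

variable {K V : Type*} [DivisionRing K] [AddCommGroup V] [Module K V]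

theorem isSimplex_pair_iff {u v : Vertex K V} : IsSimplex {u, v} ↔ u ≤ v ∨ v ≤ u := by
  constructor
  · intro h
    exact h.total (Set.mem_insert _ _) (Set.mem_insert_of_mem _ rfl)
  · rintro h
    rcases h with h | h
    · exact IsChain.pair h
    · rw [Set.pair_comm]
      exact IsChain.pair h

theorem Automorphism.comparable_iff (θ : Automorphism K V) {u v : Vertex K V} :
    (θ.toPerm u ≤ θ.toPerm v ∨ θ.toPerm v ≤ θ.toPerm u) ↔ (u ≤ v ∨ v ≤ u) := by
  rw [← isSimplex_pair_iff, ← isSimplex_pair_iff, ← θ.isSimplex_image_iff {u, v},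
    Set.image_pair]

theorem oppType_strictAnti : StrictAnti (oppType K V) := by
  intro i j hij
  have h1 : i.1 < j.1 := hij
  have := j.2
  change finrank K V - j.1 < finrank K V - i.1
  omega

variable [FiniteDimensional K V]

theorem vertexType_lt {u v : Vertex K V} (h : u < v) : vertexType K V u < vertexType K V v :=
  Submodule.finrank_lt_finrank_of_lt h

theorem vertexType_mono {u v : Vertex K V} (h : u ≤ v) : vertexType K V u ≤ vertexType K V v :=
  Submodule.finrank_mono h

/-- A subspace of a given dimension from the type set, as a vertex. -/
def vertexOfFinrank (U : Submodule K V) (i : TypeSet K V) (h : finrank K U = i) : Vertex K V :=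
  ⟨U, by rintro rfl; have := i.2.1; rw [finrank_bot] at h; omega,
    by rintro rfl; have := i.2.2; rw [finrank_top] at h; omega⟩

theorem vertexType_vertexOfFinrank {U : Submodule K V} {i : TypeSet K V} (h : finrank K U = i) :
    vertexType K V (vertexOfFinrank U i h) = i := Subtype.ext h

/-- Incidence is transitive through a middle type only when that type lies between the outer two.
This makes betweenness of types visible to the incidence relation. -/
theorem exists_not_comparable_of_lt {i j k : TypeSet K V} (hik : i < k)
    (hj : j < i ∨ k < j) : ∃ X Y Z : Vertex K V, vertexType K V X = i ∧ vertexType K V Y = j ∧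
      vertexType K V Z = k ∧ (X ≤ Y ∨ Y ≤ X) ∧ (Y ≤ Z ∨ Z ≤ Y) ∧ ¬ (X ≤ Z ∨ Z ≤ X) := by
  have hi2 := i.2
  have hj2 := j.2
  have hk2 := k.2
  have hik' : i.1 < k.1 := hik
  suffices h : ∃ X Y Z : Submodule K V, finrank K X = i ∧ finrank K Y = j ∧ finrank K Z = k ∧
      (X ≤ Y ∨ Y ≤ X) ∧ (Y ≤ Z ∨ Z ≤ Y) ∧ ¬ X ≤ Z by
    obtain ⟨X, Y, Z, hX, hY, hZ, h1, h2, h3⟩ := h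
    refine ⟨vertexOfFinrank X i hX, vertexOfFinrank Y j hY, vertexOfFinrank Z k hZ,
      vertexType_vertexOfFinrank hX, vertexType_vertexOfFinrank hY,
      vertexType_vertexOfFinrank hZ, h1, h2, ?_⟩
    rintro (h | h)
    · exact h3 h
    · have := vertexType_mono h
      rw [vertexType_vertexOfFinrank, vertexType_vertexOfFinrank] at this
      exact this.not_gt hik
  have hcons : ∀ {Z Y' W : Submodule K V}, finrank K Z = k → Z < W → Y' ≤ Z →
      finrank K Y' = i.1 - 1 → ∃ X, Y' ≤ X ∧ X ≤ W ∧ finrank K X = i ∧ ¬ X ≤ Z := by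
    intro Z Y' W hZ hZW hY' hf
    obtain ⟨x, hxW, hx⟩ := Set.exists_of_ssubset hZW
    refine ⟨Y' ⊔ K ∙ x, le_sup_left, sup_le (hY'.trans hZW.le) (by simpa using hxW), ?_, fun h =>
      hx (h (Submodule.mem_sup_right (Submodule.mem_span_singleton_self x)))⟩
    rw [finrank_sup_span_singleton fun h => hx (hY' h), hf]
    omega
  rcases hj with hj | hj
  · have hj' : j.1 < i.1 := hj
    obtain ⟨Z, -, -, hZ⟩ := exists_finrank_between (bot_le : ⊥ ≤ (⊤ : Submodule K V)) (d := k)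
      (by rw [finrank_bot]; omega) (by rw [finrank_top]; omega)
    obtain ⟨Y, -, hYZ, hY⟩ := exists_finrank_between (bot_le : ⊥ ≤ Z) (d := j)
      (by rw [finrank_bot]; omega) (by omega)
    obtain ⟨Y', hYY', hY'Z, hY'⟩ := exists_finrank_between hYZ (d := i.1 - 1)
      (by omega) (by omega)
    obtain ⟨X, hX1, -, hX2, hX3⟩ := hcons (W := ⊤) hZ
      (lt_top_iff_ne_top.2 (by rintro rfl; rw [finrank_top] at hZ; omega)) hY'Z hY'
    exact ⟨X, Y, Z, hX2, hY, hZ, Or.inr (hYY'.trans hX1), Or.inl hYZ, hX3⟩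
  · have hj' : k.1 < j.1 := hj
    obtain ⟨Y, -, -, hY⟩ := exists_finrank_between (bot_le : ⊥ ≤ (⊤ : Submodule K V)) (d := j)
      (by rw [finrank_bot]; omega) (by rw [finrank_top]; omega)
    obtain ⟨Z, -, hZY, hZ⟩ := exists_finrank_between (bot_le : ⊥ ≤ Y) (d := k)
      (by rw [finrank_bot]; omega) (by omega)
    obtain ⟨Y', -, hY'Z, hY'⟩ := exists_finrank_between (bot_le : ⊥ ≤ Z) (d := i.1 - 1)
      (by rw [finrank_bot]; omega) (by omega)
    obtain ⟨X, hX1, hX4, hX2, hX3⟩ := hcons (W := Y) hZ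
      (lt_of_le_of_ne hZY (by rintro rfl; omega)) hY'Z hY'
    exact ⟨X, Y, Z, hX2, hY, hZ, Or.inl hX4, Or.inr hZY, hX3⟩

theorem exists_not_comparable {i j k : TypeSet K V} (hik : i ≠ k)
    (hj : (j < i ∧ j < k) ∨ (i < j ∧ k < j)) : ∃ X Y Z : Vertex K V, vertexType K V X = i ∧
      vertexType K V Y = j ∧ vertexType K V Z = k ∧ (X ≤ Y ∨ Y ≤ X) ∧ (Y ≤ Z ∨ Z ≤ Y) ∧
      ¬ (X ≤ Z ∨ Z ≤ X) := by
  rcases lt_or_gt_of_ne hik with h | h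
  · exact exists_not_comparable_of_lt h (hj.imp And.left And.right)
  · obtain ⟨Z, Y, X, hZ, hY, hX, h1, h2, h3⟩ :=
      exists_not_comparable_of_lt h (hj.imp And.right And.left)
    exact ⟨X, Y, Z, hX, hY, hZ, h2.symm, h1.symm, fun h => h3 h.symm⟩

namespace Automorphism

variable {θ : Automorphism K V} {π : Equiv.Perm (TypeSet K V)}

theorem InducesOnTypes.between (h : θ.InducesOnTypes π) {i j k : TypeSet K V} (hij : i < j)
    (hjk : j < k) : (π i < π j ∧ π j < π k) ∨ (π k < π j ∧ π j < π i) := by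
  have hne : π i ≠ π k := fun h => (hij.trans hjk).ne (π.injective h)
  have hne1 : π i ≠ π j := fun h => hij.ne (π.injective h)
  have hne2 : π j ≠ π k := fun h => hjk.ne (π.injective h)
  by_contra hcon
  have h1 : (π j < π i ∧ π j < π k) ∨ (π i < π j ∧ π k < π j) := by
    rcases lt_or_gt_of_ne hne1 with h1 | h1 <;> rcases lt_or_gt_of_ne hne2 with h2 | h2
    · exact (hcon (Or.inl ⟨h1, h2⟩)).elim
    · exact Or.inr ⟨h1, h2⟩
    · exact Or.inl ⟨h1, h2⟩
    · exact (hcon (Or.inr ⟨h2, h1⟩)).elim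
  obtain ⟨X, Y, Z, hX, hY, hZ, hXY, hYZ, hXZ⟩ := exists_not_comparable hne h1
  obtain ⟨X, rfl⟩ := θ.toPerm.surjective X
  obtain ⟨Y, rfl⟩ := θ.toPerm.surjective Y
  obtain ⟨Z, rfl⟩ := θ.toPerm.surjective Z
  rw [h, π.injective.eq_iff] at hX hY hZ
  rw [θ.comparable_iff] at hXY hYZ hXZ
  have hXY' : X ≤ Y := hXY.resolve_right fun h => by
    have := vertexType_mono h
    rw [hX, hY] at this
    exact this.not_gt hij
  have hYZ' : Y ≤ Z := hYZ.resolve_right fun h => by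
    have := vertexType_mono h
    rw [hY, hZ] at this
    exact this.not_gt hjk
  exact hXZ (Or.inl (hXY'.trans hYZ'))

theorem InducesOnTypes.strictMono_or_strictAnti (h : θ.InducesOnTypes π) :
    StrictMono π ∨ StrictAnti π := by
  rcases subsingleton_or_nontrivial (TypeSet K V) with hs | ⟨i, j, hij⟩
  · exact Or.inl fun i j hij => absurd (Subsingleton.elim i j) hij.ne
  have hN : 3 ≤ finrank K V := by
    have := i.2
    have := j.2
    have : i.1 ≠ j.1 := fun h => hij (Subtype.ext h)
    omega
  have ha : ∃ a : TypeSet K V, ∀ i, a ≤ i := ⟨⟨1, by omega⟩, fun i => i.2.1⟩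
  have hb : ∃ b : TypeSet K V, ∀ i, i ≤ b := ⟨⟨finrank K V - 1, by omega⟩, fun i => by
    have := i.2
    change i.1 ≤ finrank K V - 1
    omega⟩
  obtain ⟨a, ha⟩ := ha
  obtain ⟨b, hb⟩ := hb
  have hab : a ≠ b := fun h => hij (le_antisymm ((hb i).trans (h ▸ ha j)) ((hb j).trans (h ▸ ha i)))
  -- Otherwise the preimages of the extremes a and b both lie above a; the smaller one lies between
  -- a and the other, yet its image is extreme.
  have hπa : π a = a ∨ π a = b := by
    by_contra! hcon
    have h1 : a < π.symm a := lt_of_le_of_ne (ha _) fun h => hcon.1 (by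
      rw [Equiv.eq_symm_apply] at h; exact h)
    have h2 : a < π.symm b := lt_of_le_of_ne (ha _) fun h => hcon.2 (by
      rw [Equiv.eq_symm_apply] at h; exact h)
    rcases lt_or_gt_of_ne (fun h => hab (π.symm.injective h) : π.symm a ≠ π.symm b) with h3 | h3
    · have h4 := h.between h1 h3
      simp only [Equiv.apply_symm_apply] at h4
      rcases h4 with ⟨h4, -⟩ | ⟨h4, -⟩ <;> exact (ha _).not_gt h4
    · have h4 := h.between h2 h3
      simp only [Equiv.apply_symm_apply] at h4
      rcases h4 with ⟨-, h4⟩ | ⟨-, h4⟩ <;> exact (hb _).not_gt h4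
  rcases hπa with hπ | hπ
  · left
    intro i j hij
    rcases (ha i).eq_or_lt with rfl | hi
    · rw [hπ]
      exact lt_of_le_of_ne (ha _) fun h => hij.ne (π.injective (hπ.trans h))
    · rcases h.between hi hij with h1 | h1
      · exact h1.2
      · rw [hπ] at h1
        exact ((ha _).not_gt h1.2).elim
  · right
    intro i j hij
    rcases (ha i).eq_or_lt with rfl | hi
    · rw [hπ]
      exact lt_of_le_of_ne (hb _) fun h => hij.ne (π.injective (hπ.trans h.symm))
    · rcases h.between hi hij with h1 | h1
      · rw [hπ] at h1
        exact ((hb _).not_gt h1.1).elim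
      · exact h1.1

theorem InducesOnTypes.eq_oppType (h : θ.InducesOnTypes π) (hπ : orderOf π = 2) :
    π = oppType K V := by
  rcases h.strictMono_or_strictAnti with hm | hm
  · exfalso
    have h1 : π = 1 := by
      ext1 i
      have h2 : π (π i) = i := by
        have := pow_orderOf_eq_one π
        rw [hπ, sq] at this
        exact congrArg (fun f : Equiv.Perm (TypeSet K V) => f i) this
      exact le_antisymm ((hm.le_apply (x := π i)).trans h2.le) hm.le_apply
    rw [h1, orderOf_one] at hπ
    omega
  · ext1 i
    -- Composing with `oppType` on either side gives a strictly increasing self-map, which never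
    -- decreases an element; the two resulting inequalities are the two bounds on `π i`.
    have h1 := (hm.comp oppType_strictAnti).le_apply (x := (oppType K V).symm i)
    have h2 := (oppType_strictAnti.comp hm).le_apply (x := i)
    simp only [Function.comp_apply, Equiv.apply_symm_apply] at h1 h2
    have h3 : oppType K V (oppType K V i) ≤ oppType K V (π i) :=
      ((oppType K V).symm_apply_apply i).le.trans h2
    exact le_antisymm (oppType_strictAnti.le_iff_ge.1 h3) h1

/-- An automorphism that induces opposition on the types reverses inclusion. -/
theorem InducesOnTypes.le_iff_ge (h : θ.InducesOnTypes (oppType K V)) {u v : Vertex K V} :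
    θ.toPerm u ≤ θ.toPerm v ↔ v ≤ u := by
  constructor
  · intro huv
    rcases θ.comparable_iff.1 (Or.inl huv) with h1 | h1
    · rcases h1.eq_or_lt with rfl | h1
      · exact le_rfl
      · have h2 := oppType_strictAnti (vertexType_lt h1)
        rw [← h, ← h] at h2
        exact ((vertexType_mono huv).not_gt h2).elim
    · exact h1
  · intro hvu
    rcases θ.comparable_iff.2 (Or.inl hvu) with h1 | h1
    · rcases hvu.eq_or_lt with rfl | h2
      · exact le_rfl
      · have h3 := oppType_strictAnti (vertexType_lt h2)
        rw [← h, ← h] at h3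
        exact ((vertexType_mono h1).not_gt h3).elim
    · exact h1

theorem InducesOnTypes.finrank_toPerm (h : θ.InducesOnTypes (oppType K V)) (u : Vertex K V) :
    finrank K (θ.toPerm u).1 = finrank K V - finrank K u.1 :=
  congrArg Subtype.val (h u)

end Automorphism

end TypePermutation

/-! ### The bilinear form of a duality over 𝔽₂. -/

section DualityForm

variable {V : Type*} [AddCommGroup V] [Module (ZMod 2) V] [FiniteDimensional (ZMod 2) V]

open Classical in
/-- The indicator function of the complement of a subspace. -/
noncomputable def coindicator (H : Submodule (ZMod 2) V) (v : V) : ZMod 2 := if v ∈ H then 0 else 1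

omit [FiniteDimensional (ZMod 2) V] in
theorem coindicator_eq_zero_iff {H : Submodule (ZMod 2) V} {v : V} :
    coindicator H v = 0 ↔ v ∈ H := by
  unfold coindicator
  split_ifs with h <;> simp [h]

/-- This is where the field matters: over 𝔽₂ the sum of two vectors outside a hyperplane lies in it.
The bound also admits H = ⊤, which is needed for the zero vector. -/
theorem coindicator_add {H : Submodule (ZMod 2) V}
    (hH : finrank (ZMod 2) V ≤ finrank (ZMod 2) H + 1) (u v : V) :
    coindicator H (u + v) = coindicator H u + coindicator H v := by
  by_cases hu : u ∈ H
  · rw [coindicator_eq_zero_iff.2 hu, zero_add]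
    unfold coindicator
    rw [H.add_mem_iff_right hu]
  by_cases hv : v ∈ H
  · rw [coindicator_eq_zero_iff.2 hv, add_zero]
    unfold coindicator
    rw [H.add_mem_iff_left hv]
  have huv : u + v ∈ H := by
    have hlt := Submodule.finrank_lt (s := H) (by rintro rfl; exact hu trivial)
    have hcov : H ⋖ ⊤ := covBy_of_finrank le_top (by rw [finrank_top]; omega)
    obtain ⟨a, ha⟩ := mem_of_covBy hcov trivial hv (Submodule.mem_top (x := u))
    by_cases ha0 : a = 0
    · rw [ha0, zero_smul, sub_zero] at ha
      exact (hu ha).elim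
    · rwa [zmodTwo_eq_one_of_ne_zero ha0, one_smul, ZModModule.sub_eq_add] at ha
  rw [coindicator_eq_zero_iff.2 huv]
  simp only [coindicator, hu, hv, if_false]
  decide

/-- The vertex spanned by a nonzero vector. -/
def pointVertex (hN : 2 ≤ finrank (ZMod 2) V) (x : V) (hx : x ≠ 0) : Vertex (ZMod 2) V :=
  vertexOfFinrank ((ZMod 2) ∙ x) ⟨1, le_rfl, hN⟩ (finrank_span_singleton hx)

omit [FiniteDimensional (ZMod 2) V] in
theorem pointVertex_le {hN : 2 ≤ finrank (ZMod 2) V} {x : V} {hx : x ≠ 0} {U : Vertex (ZMod 2) V} :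
    pointVertex hN x hx ≤ U ↔ x ∈ U.1 :=
  Submodule.span_singleton_le_iff_mem x U.1

open Classical in
/-- The subspace associated by a map of vertices to a vector, where zero is sent to `⊤`. -/
noncomputable def hyperplaneOf (f : Vertex (ZMod 2) V → Vertex (ZMod 2) V)
    (hN : 2 ≤ finrank (ZMod 2) V) (x : V) : Submodule (ZMod 2) V :=
  if hx : x = 0 then ⊤ else (f (pointVertex hN x hx)).1

omit [FiniteDimensional (ZMod 2) V] in
theorem finrank_hyperplaneOf {f : Vertex (ZMod 2) V → Vertex (ZMod 2) V}
    (hf : ∀ u, finrank (ZMod 2) (f u).1 = finrank (ZMod 2) V - finrank (ZMod 2) u.1)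
    (hN : 2 ≤ finrank (ZMod 2) V) (x : V) :
    finrank (ZMod 2) V ≤ finrank (ZMod 2) (hyperplaneOf f hN x) + 1 := by
  by_cases hx : x = 0
  · rw [show hyperplaneOf f hN x = ⊤ from dif_pos hx, finrank_top]
    omega
  · have : finrank (ZMod 2) (pointVertex hN x hx).1 = 1 := finrank_span_singleton hx
    rw [show hyperplaneOf f hN x = (f (pointVertex hN x hx)).1 from dif_neg hx, hf, this]
    omega

namespace Automorphism

variable {θ : Automorphism (ZMod 2) V}

theorem InducesOnTypes.symm_le_iff (h : θ.InducesOnTypes (oppType (ZMod 2) V))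
    {u v : Vertex (ZMod 2) V} : u ≤ θ.toPerm v ↔ v ≤ θ.toPerm.symm u := by
  conv_lhs => rw [← θ.toPerm.apply_symm_apply u]
  exact h.le_iff_ge

/-- This exchange of the two arguments turns additivity in the second into additivity in the first,
with the inverse of θ in place of θ. -/
theorem InducesOnTypes.mem_hyperplaneOf_comm (h : θ.InducesOnTypes (oppType (ZMod 2) V))
    (hN : 2 ≤ finrank (ZMod 2) V) {x v : V} :
    v ∈ hyperplaneOf θ.toPerm hN x ↔ x ∈ hyperplaneOf θ.toPerm.symm hN v := by
  unfold hyperplaneOf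
  split_ifs with hx hv hv
  · simp
  · simp [hx]
  · simp [hv]
  · rw [← pointVertex_le (hN := hN) (hx := hv), ← pointVertex_le (hN := hN) (hx := hx)]
    exact h.symm_le_iff

/-- A duality of the projective space over `𝔽₂` is given by a nondegenerate bilinear form. -/
theorem InducesOnTypes.exists_form (h : θ.InducesOnTypes (oppType (ZMod 2) V))
    (hN : 2 ≤ finrank (ZMod 2) V) :
    ∃ B : V →ₗ[ZMod 2] V →ₗ[ZMod 2] ZMod 2, NondegenerateOn B ⊤ ∧
      ∀ (U : Vertex (ZMod 2) V) (v : V), v ∈ (θ.toPerm U).1 ↔ ∀ u ∈ U.1, B u v = 0 := by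
  have hsymm : ∀ u, finrank (ZMod 2) (θ.toPerm.symm u).1 =
      finrank (ZMod 2) V - finrank (ZMod 2) u.1 := by
    intro u
    have h1 := h.finrank_toPerm (θ.toPerm.symm u)
    rw [Equiv.apply_symm_apply] at h1
    have h2 := Submodule.finrank_le (θ.toPerm.symm u).1
    omega
  have hcomm : ∀ x v : V, coindicator (hyperplaneOf θ.toPerm hN x) v =
      coindicator (hyperplaneOf θ.toPerm.symm hN v) x := fun x v => by
    unfold coindicator
    rw [h.mem_hyperplaneOf_comm hN]
  have hsmul : ∀ (a : ZMod 2) (H : Submodule (ZMod 2) V) (v : V),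
      coindicator H (a • v) = a • coindicator H v := by
    intro a H v
    by_cases ha : a = 0
    · rw [ha, zero_smul, zero_smul]
      exact coindicator_eq_zero_iff.2 H.zero_mem
    · rw [zmodTwo_eq_one_of_ne_zero ha, one_smul, one_smul]
  let B : V →ₗ[ZMod 2] V →ₗ[ZMod 2] ZMod 2 := LinearMap.mk₂ (ZMod 2)
    (fun x v => coindicator (hyperplaneOf θ.toPerm hN x) v)
    (fun x y v => by
      simp only [hcomm]
      exact coindicator_add (finrank_hyperplaneOf hsymm hN v) x y)
    (fun a x v => by
      simp only [hcomm]
      exact hsmul _ _ _)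
    (fun x u v => coindicator_add (finrank_hyperplaneOf h.finrank_toPerm hN x) u v)
    (fun a x v => hsmul _ _ _)
  have hB : ∀ x v, B x v = 0 ↔ x ∈ hyperplaneOf θ.toPerm.symm hN v := fun x v => by
    rw [← h.mem_hyperplaneOf_comm hN]
    exact coindicator_eq_zero_iff
  refine ⟨B, fun v _ hv => ?_, fun U v => ?_⟩
  · by_contra hv0
    have htop : hyperplaneOf θ.toPerm.symm hN v = ⊤ :=
      top_le_iff.1 fun x _ => (hB x v).1 (hv x trivial)
    rw [hyperplaneOf, dif_neg hv0] at htop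
    exact (θ.toPerm.symm _).2.2 htop
  · simp only [hB]
    by_cases hv0 : v = 0
    · simp [hv0, hyperplaneOf]
    · rw [hyperplaneOf, dif_neg hv0, ← pointVertex_le (hN := hN) (hx := hv0), h.symm_le_iff]
      exact Iff.rfl

end Automorphism

end DualityForm

/-! ### Nondegenerate flags and the opposite geometry. -/

section Main

variable {V : Type*} [AddCommGroup V] [Module (ZMod 2) V]
  {B : V →ₗ[ZMod 2] V →ₗ[ZMod 2] ZMod 2}

/-- The right orthogonal complement. -/
def rightPerp (B : V →ₗ[ZMod 2] V →ₗ[ZMod 2] ZMod 2) (U : Submodule (ZMod 2) V) :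
    Submodule (ZMod 2) V where
  carrier := {v | ∀ u ∈ U, B u v = 0}
  zero_mem' := fun u _ => map_zero _
  add_mem' := fun {v w} hv hw u hu => by rw [map_add, hv u hu, hw u hu, add_zero]
  smul_mem' := fun a v hv u hu => by rw [map_smul, hv u hu, smul_zero]

theorem NondegenerateOn.inf_rightPerp {U : Submodule (ZMod 2) V} (h : NondegenerateOn B U) :
    U ⊓ rightPerp B U = ⊥ :=
  (Submodule.eq_bot_iff _).2 fun v hv => h v hv.1 hv.2

/-- The image of a flag under the duality given by the form `B`. -/
noncomputable def dualFlag (B : V →ₗ[ZMod 2] V →ₗ[ZMod 2] ZMod 2)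
    (c : ℕ → Submodule (ZMod 2) V) (i : ℕ) : Submodule (ZMod 2) V :=
  rightPerp B (c (finrank (ZMod 2) V - i))

variable [FiniteDimensional (ZMod 2) V] {θ : Automorphism (ZMod 2) V}
  {c : ℕ → Submodule (ZMod 2) V}

theorem IsFullFlag.dualFlag (hc : IsFullFlag c) (h : θ.InducesOnTypes (oppType (ZMod 2) V))
    (hB : NondegenerateOn B ⊤)
    (hθ : ∀ U : Vertex (ZMod 2) V, (θ.toPerm U).1 = rightPerp B U.1) :
    IsFullFlag (dualFlag B c) := by
  refine ⟨fun i j hij v hv u hu => hv u (hc.mono (by omega) hu), fun i => ?_⟩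
  rcases Nat.eq_zero_or_pos i with rfl | h0
  · have h1 : TypeABuilding.dualFlag B c 0 = ⊥ := by
      rw [TypeABuilding.dualFlag, hc.top (by omega), ← hB.inf_rightPerp, top_inf_eq]
    rw [h1, finrank_bot]
    omega
  rcases lt_or_ge i (finrank (ZMod 2) V) with h1 | h1
  · have h2 := h.finrank_toPerm (hc.vertex ⟨finrank (ZMod 2) V - i, by omega, by omega⟩)
    rw [hθ] at h2
    refine h2.trans ?_
    change _ - finrank (ZMod 2) (c (finrank (ZMod 2) V - i)) = _
    rw [hc.finrank_eq]
    omega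
  · have h2 : TypeABuilding.dualFlag B c i = ⊤ := by
      rw [TypeABuilding.dualFlag, show finrank (ZMod 2) V - i = 0 by omega, hc.bot]
      refine top_le_iff.1 fun v _ u hu => ?_
      rw [(Submodule.mem_bot _).1 hu, map_zero, LinearMap.zero_apply]
    rw [h2, finrank_top]
    omega

omit [FiniteDimensional (ZMod 2) V] in
theorem IsFullFlag.toPerm_vertex (hc : IsFullFlag c)
    (hθ : ∀ U : Vertex (ZMod 2) V, (θ.toPerm U).1 = rightPerp B U.1) (k : TypeSet (ZMod 2) V) :
    (θ.toPerm (hc.vertex k)).1 = TypeABuilding.dualFlag B c (finrank (ZMod 2) V - k.1) := by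
  have := k.2
  rw [hθ, TypeABuilding.dualFlag, show finrank (ZMod 2) V - (finrank (ZMod 2) V - k.1) = k.1 by
    omega]
  rfl

theorem IsFullFlag.image_flagSet (hc : IsFullFlag c)
    (hd : IsFullFlag (TypeABuilding.dualFlag B c))
    (hθ : ∀ U : Vertex (ZMod 2) V, (θ.toPerm U).1 = rightPerp B U.1) :
    θ.image (flagSet c) = flagSet (TypeABuilding.dualFlag B c) := by
  ext v
  constructor
  · rintro ⟨u, hu, rfl⟩
    rw [hc.eq_vertex hu]
    exact ⟨_, hc.toPerm_vertex hθ _⟩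
  · intro hv
    have ht := (vertexType (ZMod 2) V v).2
    refine ⟨hc.vertex ⟨finrank (ZMod 2) V - (vertexType (ZMod 2) V v).1, by omega, by omega⟩,
      hc.vertex_mem _, Subtype.ext ?_⟩
    rw [hc.toPerm_vertex hθ, hd.val_eq hv]
    congr 1
    change finrank (ZMod 2) V - (finrank (ZMod 2) V - (vertexType (ZMod 2) V v).1) = _
    omega

theorem IsFullFlag.simplexType_image (hc : IsFullFlag c) (J : Set (TypeSet (ZMod 2) V)) :
    simplexType (hc.vertex '' J) = J := by
  rw [simplexType, Set.image_image]
  simp only [hc.vertexType_vertex, Set.image_id']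

omit [FiniteDimensional (ZMod 2) V] in
theorem IsFullFlag.image_vertex_subset (hc : IsFullFlag c) (J : Set (TypeSet (ZMod 2) V)) :
    hc.vertex '' J ⊆ flagSet c := by
  rintro _ ⟨k, -, rfl⟩
  exact hc.vertex_mem k

/-- Nondegeneracy on `c k` makes it a complement of its image, which is the input of
`exists_opposite`. That lemma is applied once from each side, the second time with complementary
indices. -/
theorem IsFullFlag.mem_Opp (hc : IsFullFlag c) (hd : IsFullFlag (TypeABuilding.dualFlag B c))
    (hθ : ∀ U : Vertex (ZMod 2) V, (θ.toPerm U).1 = rightPerp B U.1)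
    (J : Set (TypeSet (ZMod 2) V)) (hJ : ∀ k ∈ J, NondegenerateOn B (c k.1)) :
    hc.vertex '' J ∈ θ.Opp := by
  refine ⟨hc.isSimplex.mono (hc.image_vertex_subset J), ?_, ?_⟩
  · rintro ⟨A, hA⟩ hσA
    obtain ⟨a, ha, rfl⟩ := hA.exists_isFullFlag
    have hac : ∀ k ∈ J, c k.1 = a k.1 := fun k hk => hc.eq_of_vertex_mem ha k (hσA ⟨k, hk, rfl⟩)
    obtain ⟨b, hb, hab, hbd⟩ := ha.exists_opposite hd (Subtype.val '' J) (by
      rintro _ ⟨k, hk, rfl⟩ hkN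
      rw [← hac k hk, TypeABuilding.dualFlag,
        show finrank (ZMod 2) V - (finrank (ZMod 2) V - k.1) = k.1 by omega]
      exact (hJ k hk).inf_rightPerp)
    refine ⟨hb.chamber, ?_, (ha.oppositeChambers_iff hb).2 hab⟩
    rintro _ ⟨_, ⟨k, hk, rfl⟩, rfl⟩
    exact ⟨_, (hc.toPerm_vertex hθ k).trans (hbd _ ⟨k, hk, rfl⟩ k.2.2.le).symm⟩
  · rintro ⟨D, hD⟩ hσD
    obtain ⟨b, hb, rfl⟩ := hD.exists_isFullFlag
    have hbc : ∀ k ∈ J, b (finrank (ZMod 2) V - k.1) = rightPerp B (c k.1) := fun k hk => by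
      have h1 := hb.val_eq (hσD ⟨_, ⟨k, hk, rfl⟩, rfl⟩)
      have h2 : (vertexType (ZMod 2) V (θ.toPerm (hc.vertex k))).1 =
          finrank (ZMod 2) V - k.1 := by
        change finrank (ZMod 2) (θ.toPerm (hc.vertex k)).1 = _
        rw [hc.toPerm_vertex hθ, hd.finrank_eq]
        omega
      rw [h2, hθ] at h1
      exact h1.symm
    obtain ⟨a, ha, hba, hac⟩ := hb.exists_opposite hc
      ((fun k : TypeSet (ZMod 2) V => finrank (ZMod 2) V - k.1) '' J) (by
      rintro _ ⟨k, hk, rfl⟩ hkN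
      have := k.2
      beta_reduce
      rw [hbc k hk, show finrank (ZMod 2) V - (finrank (ZMod 2) V - k.1) = k.1 by omega, inf_comm]
      exact (hJ k hk).inf_rightPerp)
    refine ⟨ha.chamber, ?_, (ha.oppositeChambers_iff hb).2 fun i hi => ?_⟩
    · rintro _ ⟨k, hk, rfl⟩
      have := k.2
      have h1 := hac _ ⟨k, hk, rfl⟩ (Nat.sub_le _ _)
      beta_reduce at h1
      rw [show finrank (ZMod 2) V - (finrank (ZMod 2) V - k.1) = k.1 by omega] at h1
      exact ⟨k.1, h1.symm⟩
    · have h1 := hba (finrank (ZMod 2) V - i) (by omega)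
      rwa [show finrank (ZMod 2) V - (finrank (ZMod 2) V - i) = i by omega, inf_comm] at h1

/-- A chamber through σ has an opposite chamber through the image of σ, whose member in the
dimension complementary to u is the image of u. -/
theorem Automorphism.inf_toPerm_eq_bot (h : θ.InducesOnTypes (oppType (ZMod 2) V))
    {σ : Set (Vertex (ZMod 2) V)} (hσ : σ ∈ θ.Opp) {u : Vertex (ZMod 2) V} (hu : u ∈ σ) :
    u.1 ⊓ (θ.toPerm u).1 = ⊥ := by
  obtain ⟨a, ha, hσa⟩ := exists_isFullFlag hσ.1
  obtain ⟨⟨D, hD⟩, hσD, hopp⟩ := hσ.2.1 ha.chamber hσa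
  obtain ⟨b, hb, rfl⟩ := hD.exists_isFullFlag
  have h1 := (ha.oppositeChambers_iff hb).1 hopp _ (vertexType (ZMod 2) V u).2.2.le
  have h2 := hb.val_eq (hσD ⟨u, hu, rfl⟩)
  rw [h] at h2
  rw [ha.val_eq (hσa hu), h2]
  exact h1

theorem exists_apply_self_eq_one {U : Submodule (ZMod 2) V} (hU : finrank (ZMod 2) U = 1)
    (h : U ⊓ rightPerp B U = ⊥) : ∃ x, B x x = 1 := by
  obtain ⟨x, hxU, hx0⟩ := Submodule.exists_mem_ne_zero_of_ne_bot
    (p := U) (by rintro rfl; rw [finrank_bot] at hU; omega)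
  have hspan : (ZMod 2) ∙ x = U := Submodule.eq_of_le_of_finrank_eq (by simpa using hxU)
    (by rw [hU, finrank_span_singleton hx0])
  refine ⟨x, zmodTwo_eq_one_of_ne_zero fun hxx => hx0 ?_⟩
  rw [← Submodule.mem_bot (ZMod 2), ← h]
  refine ⟨hxU, fun u hu => ?_⟩
  rw [← hspan] at hu
  obtain ⟨a, rfl⟩ := Submodule.mem_span_singleton.1 hu
  simp [hxx]

omit [FiniteDimensional (ZMod 2) V] in
theorem IsFlagOf.isFullFlag (hc : IsFlagOf ⊤ c) : IsFullFlag c :=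
  ⟨hc.mono, fun i => by rw [hc.finrank_eq, finrank_top]⟩

end Main

end TypeABuilding

open TypeABuilding in
theorem mainTheorem8 (n : ℕ) {V : Type*} [AddCommGroup V] [Module (ZMod 2) V]
    [FiniteDimensional (ZMod 2) V] (hV : Module.finrank (ZMod 2) V = n + 1)
    (θ : TypeABuilding.Automorphism (ZMod 2) V) (hdual : θ.IsDuality)
    (hθ : θ.ExceptionalDomestic) :
    θ.StronglyExceptionalDomestic ∧
      ∀ s : TypeABuilding.TypeSet (ZMod 2) V,
        ∃ P : Set (TypeABuilding.Vertex (ZMod 2) V),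
          TypeABuilding.IsPanel P ∧ TypeABuilding.simplexType P = {s}ᶜ ∧
            TypeABuilding.IsPanel (θ.image P) ∧
            TypeABuilding.OppositeSimplices P (θ.image P) := by
  obtain ⟨π, hπ, hord⟩ := hdual
  obtain rfl := hπ.eq_oppType hord
  have hN : 3 ≤ Module.finrank (ZMod 2) V := by
    by_contra hlt
    have h1 : oppType (ZMod 2) V = 1 := by
      ext1 i
      apply Subtype.ext
      have := i.2
      change Module.finrank (ZMod 2) V - i.1 = i.1
      omega
    rw [h1, orderOf_one] at hord
    omega
  obtain ⟨B, hB, hBθ⟩ := hπ.exists_form (by omega)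
  have hperp : ∀ U : Vertex (ZMod 2) V, (θ.toPerm U).1 = rightPerp B U.1 := fun U =>
    Submodule.ext fun v => hBθ U v
  -- Type 1 belongs to the opposition diagram, so some point is not contained in its image.
  have hpoint : ∃ x ∈ (⊤ : Submodule (ZMod 2) V), B x x = 1 := by
    have h1 : (⟨1, le_rfl, by omega⟩ : TypeSet (ZMod 2) V) ∈ θ.typ := by
      rw [hθ.2]
      trivial
    obtain ⟨J, ⟨σ, hσ, rfl⟩, u, hu, h1⟩ := h1
    have h2 := Automorphism.inf_toPerm_eq_bot hπ hσ hu
    rw [hperp] at h2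
    obtain ⟨x, hx⟩ := exists_apply_self_eq_one (congrArg Subtype.val h1) h2
    exact ⟨x, trivial, hx⟩
  have hdom : ¬ ∃ c, IsFlagOf (⊤ : Submodule (ZMod 2) V) c ∧ ∀ i, NondegenerateOn B (c i) := by
    rintro ⟨c, hc, hcn⟩
    have hc' := hc.isFullFlag
    have h1 := hc'.mem_Opp (hc'.dualFlag hπ hB hperp) hperp Set.univ fun k _ => hcn k.1
    refine hθ.1 ⟨_, h1, ?_⟩
    have h2 : hc'.vertex '' Set.univ = flagSet c :=
      (hc'.image_vertex_subset _).antisymm fun v hv => ⟨_, trivial, (hc'.eq_vertex hv).symm⟩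
    rw [h2]
    exact hc'.isChamber
  have hflag : ∀ s : TypeSet (ZMod 2) V, ∃ c : ℕ → Submodule (ZMod 2) V, IsFullFlag c ∧
      ∀ i, i ≠ s.1 → NondegenerateOn B (c i) := by
    intro s
    have hs := s.2
    obtain ⟨c, hc, hcn⟩ := exists_flag_nondegenerateOn_of_ne
      (Module.finrank (ZMod 2) V - 2) ⊤ (by rw [finrank_top]; omega) hB (fun _ => hpoint) hdom
      s.1 hs.1 (by omega)
    exact ⟨c, hc.isFullFlag, hcn⟩
  refine ⟨⟨hθ.1, _, hπ, fun J hJ _ hJdom => ?_⟩, fun s => ?_⟩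
  · obtain ⟨s, hs⟩ := (Set.ne_univ_iff_exists_notMem J).1 hJ
    -- With s outside J, the flag that may degenerate only in dimension s is nondegenerate in every
    -- dimension from J.
    obtain ⟨c, hc, hcn⟩ := hflag s
    exact hJdom ⟨_, hc.mem_Opp (hc.dualFlag hπ hB hperp) hperp J fun k hk =>
      hcn k.1 fun h => hs (Subtype.ext h ▸ hk), hc.simplexType_image J⟩
  · obtain ⟨c, hc, hcn⟩ := hflag s
    have hd := hc.dualFlag hπ hB hperp
    have hP : hc.vertex '' {s}ᶜ = flagSet c \ {hc.vertex s} := by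
      ext v
      constructor
      · rintro ⟨k, hk, rfl⟩
        refine ⟨hc.vertex_mem k, fun h => hk ?_⟩
        rw [Set.mem_singleton_iff] at h ⊢
        rw [← hc.vertexType_vertex k, h, hc.vertexType_vertex]
      · rintro ⟨hv, hvs⟩
        refine ⟨vertexType (ZMod 2) V v, fun h => hvs ?_, (hc.eq_vertex hv).symm⟩
        rw [Set.mem_singleton_iff] at h ⊢
        rw [hc.eq_vertex hv, h]
    refine ⟨hc.vertex '' {s}ᶜ, ⟨_, hc.isChamber, _, hc.vertex_mem s, hP⟩,
      hc.simplexType_image _, ⟨_, hd.isChamber, θ.toPerm (hc.vertex s), ?_, ?_⟩,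
      (hc.mem_Opp hd hperp {s}ᶜ fun k hk => hcn k.1 fun h => hk (Subtype.ext h)).2⟩
    · rw [← hc.image_flagSet hd hperp]
      exact ⟨_, hc.vertex_mem s, rfl⟩
    · rw [hP, ← hc.image_flagSet hd hperp, Automorphism.image, Automorphism.image,
        Set.image_sdiff θ.toPerm.injective, Set.image_singleton]
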